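/- All graphs are finite and simple. For a graph $G$, let $e(G)$ be its number of edges, and let $G^2$ be the graph with the same vertex set in which two distinct vertices are adjacent if and only if their distance in $G$ is at most $2$. Fix an integer $d$. A vertex set $R$ of $G$ is a *B region with end vertex $w$* if $|R| = d+2$ and the complement of the induced subgraph $G[R]$ consists exactly of two edges $wp$, $wq$ with $p \neq q$, together with a perfect matching on the other $d-1$ vertices of $R$. *Tails* are defined recursively: a B region with end vertex $w$ is a tail with end vertex $w$; and if $T$ is a tail with end vertex $w$, $R$ is a set of $d+1$ vertices disjoint from $T$ that induces a clique with exactly one edge $ab$ removed, and $wa$ is the only edge between $T$ and $R$, then $T \cup R$ is a tail with end vertex $b$. A graph $G$ is a *snake graph* if $V(G)$ is the disjoint union of two tails $T$, $T'$ with end vertices $w$, $w'$, and $ww'$ is the only edge between $T$ and $T'$. A graph $G$ is a *peanut graph* if $V(G)$ can be partitioned into sets $R_1$ and $R_2$ with $|R_1| = d+1$ and $|R_2| = d+2$ such that: the complement of $G[R_1]$ has exactly one edge $w_1w_2$; the complement of $G[R_2]$ consists exactly of three edges $uv_1, uv_2, uv_3$ (with $v_1,v_2,v_3$ distinct) together with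 a perfect matching on the other $d-2$ vertices of $R_2$; and the only edges between $R_1$ and $R_2$ are $uw_1$ and $uw_2$. **Theorem.** Let $d > 6$, and let $G$ be a connected $d$-regular graph on $n$ vertices such that $G^2$ is not complete. Suppose that $G$ is neither a snake graph nor a peanut graph. Then $$e(G^2) - e(G) > 2n\left(1 - \frac{2}{d+1} - \frac{3}{d-3}\right).$$ -/

import Mathlib

/-- The `k`-th power `G ^ k` of a graph: distinct vertices are joined if and only if their
distance in `G` is at most `k`. -/
def graphPower {V : Type*} (G : SimpleGraph V) (k : ℕ) : SimpleGraph V where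
  Adj u v := u ≠ v ∧ G.edist u v ≤ (k : ℕ∞)
  symm := ⟨fun u v h => ⟨h.1.symm, by rw [SimpleGraph.edist_comm]; exact h.2⟩⟩
  loopless := ⟨fun _ h => h.1 rfl⟩

/-- The complement of the induced subgraph `G[R]` consists exactly of the star with centre `u` and
set of leaves `S`, together with a perfect matching on the remaining vertices of `R`. -/
structure IsCoStarMatching {V : Type*} (G : SimpleGraph V) (R : Set V) (u : V) (S : Set V) :
    Prop where
  center_mem : u ∈ R
  leaves_subset : S ⊆ R
  center_iff : ∀ y ∈ R, Gᶜ.Adj u y ↔ y ∈ S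
  leaf_iff : ∀ s ∈ S, ∀ y ∈ R, Gᶜ.Adj s y ↔ y = u
  matching : ∀ x ∈ R, x ≠ u → x ∉ S → ∃! y, y ∈ R ∧ Gᶜ.Adj x y

/-- `G[R]` is a clique on `d + 1` vertices with the single edge `ab` removed. -/
structure IsCliqueMinusEdge {V : Type*} (G : SimpleGraph V) (d : ℕ) (R : Set V) (a b : V) :
    Prop where
  ncard_eq : R.ncard = d + 1
  left_mem : a ∈ R
  right_mem : b ∈ R
  ne : a ≠ b
  compl_iff : ∀ x ∈ R, ∀ y ∈ R, Gᶜ.Adj x y ↔ (x = a ∧ y = b) ∨ (x = b ∧ y = a)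

/-- `R` is a B region of the `d`-regular graph `G`: it has `d + 2` vertices, and the complement of
`G[R]` is a path with two edges and midpoint `w` together with a perfect matching on the other
`d - 1` vertices. The vertex `w` is the only vertex of `R` whose degree in `G[R]` is `d - 1`;
the others have degree `d`. -/
def IsBRegion {V : Type*} (G : SimpleGraph V) (d : ℕ) (R : Set V) (w : V) : Prop :=
  R.ncard = d + 2 ∧ ∃ S : Set V, S.ncard = 2 ∧ IsCoStarMatching G R w S

/-- `IsTail G d T w`: the set `T` induces a tail of the `d`-regular graph `G`, that is, a B region
followed by a sequence (possibly empty) of cliques on `d + 1` vertices with one edge removed, where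
consecutive segments are joined by a single edge between their vertices of deficient degree. The
vertex `w` is the vertex of `T` that still has degree `d - 1` in `G[T]`. -/
inductive IsTail {V : Type*} (G : SimpleGraph V) (d : ℕ) : Set V → V → Prop
  | base (R : Set V) (w : V) : IsBRegion G d R w → IsTail G d R w
  | step (T : Set V) (w : V) (R : Set V) (a b : V) : IsTail G d T w → Disjoint T R →
      IsCliqueMinusEdge G d R a b → (∀ x ∈ T, ∀ y ∈ R, G.Adj x y ↔ x = w ∧ y = a) →
      IsTail G d (T ∪ R) b

/-- A snake graph: the disjoint union of two tails, together with a single edge that joins their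
vertices of deficient degree. -/
def IsSnakeGraph {V : Type*} (G : SimpleGraph V) (d : ℕ) : Prop :=
  ∃ (T T' : Set V) (w w' : V), IsTail G d T w ∧ IsTail G d T' w' ∧ Disjoint T T' ∧
    T ∪ T' = Set.univ ∧ ∀ x ∈ T, ∀ y ∈ T', G.Adj x y ↔ x = w ∧ y = w'

/-- A peanut graph: the vertex set is partitioned into `R₁` and `R₂` with `d + 1` and `d + 2`
vertices; the only edge in the complement of `G[R₁]` is `w₁w₂`; the complement of `G[R₂]` consists
of three edges at a vertex `u` and a perfect matching on the vertices of `R₂` not on these edges;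
and the only edges between `R₁` and `R₂` are `uw₁` and `uw₂`. -/
def IsPeanutGraph {V : Type*} (G : SimpleGraph V) (d : ℕ) : Prop :=
  ∃ (R₁ R₂ : Set V) (w₁ w₂ u : V) (S : Set V), Disjoint R₁ R₂ ∧ R₁ ∪ R₂ = Set.univ ∧
    IsCliqueMinusEdge G d R₁ w₁ w₂ ∧
    R₂.ncard = d + 2 ∧ S.ncard = 3 ∧ IsCoStarMatching G R₂ u S ∧
    ∀ x ∈ R₁, ∀ y ∈ R₂, G.Adj x y ↔ (x = w₁ ∨ x = w₂) ∧ y = u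

set_option linter.unusedSectionVars false

/-! Twice `e(G²) - e(G)` is the sum of `|N2 v|`, so the theorem is a lower bound on the average
number of vertices at distance two. For `d ≥ 9` discharging shows that this average is at least `tau
d = 4 - 20/d`, which exceeds the required bound; for `d = 7, 8` the bound is so weak that `|N2 v| ≥
1` suffices.

Each `v` starts with charge `|N2 v|`, and only vertices with `|N2 v| ≤ 3` are poor. By `outer_card`,
a vertex of `N2 v` that touches distance three from a poor `v` has at least `d - 2` second
neighbours. It can therefore send `alpha d = 1 - 4/(d-2)` to each of them and still keep `4 ≥ tau
d`. In the first step such outer vertices pay the poor vertices. Two kinds abstain, because their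
charge is needed nearby: the end of a tail does not pay outside its tail (`forb`), and a neighbour
of a vertex with a single second neighbour pays nothing (`res`). In the second step every surplus
above `tau d` is divided among nearby vertices with at most two second neighbours.

The first step settles all vertices with `|N2 v| ≥ 3` (`tau_le_ch`). When `|N2 v| ≤ 2` and the gifts
do not suffice, a dense set around `v` is attached to the rest at a cut vertex `q`, up to a tail.
The neighbours of `q` inside this set see many vertices through `q`, and their surplus pays for `v`
(`tau_le_of_card_eq_one`, `tau_le_of_inner`, `tau_le_of_forb`). Parity of degree sums limits how
such sets can be attached. The rules fail to find a donor only in two situations: tails facing each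
other, which form a snake graph, and the configuration in `res_outer`, which is a peanut graph. -/

namespace RegularSquare
-- Second neighbourhoods, degree counts and parity.
section Basic
open scoped Classical
open Finset
variable {V : Type*} [Fintype V] {G : SimpleGraph V} {d : ℕ}

/-- The open neighbourhood of `v`. -/
noncomputable def nb (G : SimpleGraph V) (v : V) : Finset V := univ.filter fun y => G.Adj v y

/-- The closed neighbourhood of `v`. -/
noncomputable def cl (G : SimpleGraph V) (v : V) : Finset V := insert v (nb G v)

/-- The vertices at distance exactly two from `v`. -/
noncomputable def N2 (G : SimpleGraph V) (v : V) : Finset V :=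
  univ.filter fun x => x ≠ v ∧ ¬ G.Adj v x ∧ ∃ y, G.Adj v y ∧ G.Adj y x

/-- The vertices at distance two from `v` that have a neighbour at distance three from `v`. -/
noncomputable def outer (G : SimpleGraph V) (v : V) : Finset V :=
  (N2 G v).filter fun x => ∃ y, G.Adj x y ∧ y ∉ cl G v ∧ y ∉ N2 G v

/-- The vertices of `P` other than `v` that are not adjacent to `v`. -/
noncomputable def nonnb (G : SimpleGraph V) (P : Finset V) (v : V) : Finset V :=
  P.filter fun y => y ≠ v ∧ ¬ G.Adj v y

@[simp] lemma mem_nb {v y : V} : y ∈ nb G v ↔ G.Adj v y := by simp [nb]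

@[simp] lemma mem_cl {v y : V} : y ∈ cl G v ↔ y = v ∨ G.Adj v y := by simp [cl]

lemma mem_N2 {v x : V} :
    x ∈ N2 G v ↔ x ≠ v ∧ ¬ G.Adj v x ∧ ∃ y, G.Adj v y ∧ G.Adj y x := by simp [N2]

lemma mem_outer {v x : V} :
    x ∈ outer G v ↔ x ∈ N2 G v ∧ ∃ y, G.Adj x y ∧ y ∉ cl G v ∧ y ∉ N2 G v := by simp [outer]

@[simp] lemma mem_nonnb {P : Finset V} {v y : V} :
    y ∈ nonnb G P v ↔ y ∈ P ∧ y ≠ v ∧ ¬ G.Adj v y := by simp [nonnb]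

lemma N2_comm {v x : V} : x ∈ N2 G v ↔ v ∈ N2 G x := by
  simp only [mem_N2]
  constructor <;> rintro ⟨h1, h2, y, h3, h4⟩ <;>
    exact ⟨h1.symm, fun h => h2 h.symm, y, h4.symm, h3.symm⟩

lemma outer_subset (v : V) : outer G v ⊆ N2 G v := filter_subset _ _

/-- Standing hypotheses on the graph. -/
structure Ctx (G : SimpleGraph V) (d : ℕ) : Prop where
  deg : 9 ≤ d
  reg : ∀ v, (nb G v).card = d
  conn : G.Connected
  diam : ∃ x y, x ≠ y ∧ ¬ G.Adj x y ∧ y ∉ N2 G x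
  not_snake : ¬ IsSnakeGraph G d
  not_peanut : ¬ IsPeanutGraph G d

lemma cl_card (hreg : ∀ v, (nb G v).card = d) (v : V) : (cl G v).card = d + 1 := by
  rw [cl, card_insert_of_notMem (by simp), hreg]

/-- The basic exchange rate: by regularity, non-neighbours of `v` inside `P` and neighbours of `v`
outside `P` determine each other's number once `|P|` is known. -/
lemma nonnb_card (hreg : ∀ v, (nb G v).card = d) {P : Finset V} {v : V} (hv : v ∈ P) :
    (nonnb G P v).card + d + 1 = P.card + (nb G v \ P).card := by
  have h1 : (nb G v ∩ P).card + (nb G v \ P).card = d := by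
    rw [card_inter_add_card_sdiff, hreg]
  have h2 : P = insert v (nonnb G P v ∪ (nb G v ∩ P)) := by
    ext y
    simp only [mem_insert, mem_union, mem_nonnb, mem_inter, mem_nb]
    by_cases h : y = v
    · simp [h, hv]
    · by_cases h' : G.Adj v y <;> simp [h, h']
  have h3 : P.card = 1 + ((nonnb G P v).card + (nb G v ∩ P).card) := by
    conv_lhs => rw [h2]
    rw [card_insert_of_notMem (by simp), card_union_of_disjoint, add_comm]
    rw [disjoint_left]; intro y; simp; tauto
  omega

lemma nb_sdiff_card (hreg : ∀ v, (nb G v).card = d) (P : Finset V) (v : V) :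
    (nb G v ∩ P).card + (nb G v \ P).card = d := by
  rw [card_inter_add_card_sdiff, hreg]

lemma closed_univ (hc : G.Connected) {W : Set V} (hne : W.Nonempty)
    (h : ∀ v ∈ W, ∀ y, G.Adj v y → y ∈ W) : W = Set.univ := by
  obtain ⟨a, ha⟩ := hne
  ext b
  simp only [Set.mem_univ, iff_true]
  obtain ⟨p⟩ := hc.preconnected a b
  induction p with
  | nil => exact ha
  | cons hadj _ ih => exact ih (h _ ha _ hadj)

lemma even_sum_inter (W : Finset V) : Even (∑ v ∈ W, (nb G v ∩ W).card) := by
  let H : SimpleGraph V :=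
    { Adj := fun a b => G.Adj a b ∧ a ∈ W ∧ b ∈ W
      symm := ⟨fun a b h => ⟨h.1.symm, h.2.2, h.2.1⟩⟩
      loopless := ⟨fun a h => G.loopless.irrefl a h.1⟩ }
  have h1 : ∀ v, H.degree v = if v ∈ W then (nb G v ∩ W).card else 0 := by
    intro v
    rw [← SimpleGraph.card_neighborFinset_eq_degree]
    split_ifs with h
    · congr 1
      ext y; simp [H, h]
    · rw [card_eq_zero, eq_empty_iff_forall_notMem]
      intro y; simp [H, h]
  have h2 := H.sum_degrees_eq_twice_card_edges
  simp only [h1, sum_ite_mem, univ_inter] at h2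
  rw [h2]; exact even_two_mul _

/-- The degrees over `W` sum to `d|W|`; removing the edges to `X` leaves the degree sum of `G[W]`,
which is even. Every parity argument below rests on this. -/
lemma even_boundary (hreg : ∀ v, (nb G v).card = d) {W X : Finset V} (hd : Disjoint W X)
    (hout : ∀ v ∈ W, ∀ y, G.Adj v y → y ∈ W ∨ y ∈ X) :
    Even (d * W.card + ∑ x ∈ X, (nb G x ∩ W).card) := by
  have h1 : ∑ v ∈ W, (nb G v ∩ X).card = ∑ x ∈ X, (nb G x ∩ W).card := by
    have := sum_card_bipartiteAbove_eq_sum_card_bipartiteBelow (s := W) (t := X) G.Adj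
    convert this using 2 with v hv x hx
    · congr 1; ext y; simp [bipartiteAbove, and_comm]
    · congr 1; ext y; simp [bipartiteBelow, and_comm, G.adj_comm]
  have h2 : ∀ v ∈ W, d = (nb G v ∩ W).card + (nb G v ∩ X).card := by
    intro v hv
    rw [← card_union_of_disjoint, ← hreg v]
    · congr 1; ext y
      simp only [mem_nb, mem_union, mem_inter]
      constructor
      · intro h; rcases hout v hv y h with h' | h' <;> simp [h, h']
      · tauto
    · exact Disjoint.mono inter_subset_right inter_subset_right hd
  have h3 : d * W.card = ∑ v ∈ W, (nb G v ∩ W).card + ∑ x ∈ X, (nb G x ∩ W).card := by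
    rw [← h1, ← sum_add_distrib, ← sum_congr rfl h2]; simp [mul_comm]
  rw [h3, add_assoc]
  exact (even_sum_inter W).add ⟨_, rfl⟩

/-- Two vertices of a set in which both have few non-neighbours have a common neighbour. -/
lemma common_nb {P : Finset V} {x y : V}
    (hxP : x ∈ P) (hyP : y ∈ P) (hxy : x ≠ y) (ha : ¬ G.Adj x y)
    (hc : (nonnb G P x).card + (nonnb G P y).card < P.card) : y ∈ N2 G x := by
  by_contra hn
  have : P ⊆ nonnb G P x ∪ nonnb G P y := by
    intro z hz
    by_contra hz'
    simp only [mem_union, mem_nonnb, hz, true_and, not_or, not_and, not_not] at hz'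
    by_cases h1 : z = x
    · subst h1; exact ha (hz'.2 hxy).symm
    by_cases h2 : z = y
    · subst h2; exact ha (hz'.1 h1)
    · exact hn (mem_N2.2 ⟨hxy.symm, ha, z, hz'.1 h1, (hz'.2 h2).symm⟩)
  have := (card_le_card this).trans (card_union_le _ _)
  omega

/-- Otherwise the ball of radius two is the whole graph, which then has at most `d + 4` vertices.
Each vertex has at most three non-neighbours, so any two non-adjacent vertices have a common
neighbour, against the diameter hypothesis. -/
lemma outer_nonempty (h : Ctx G d) {v : V} (hs : (N2 G v).card ≤ 3) : (outer G v).Nonempty := by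
  by_contra hne
  rw [not_nonempty_iff_eq_empty] at hne
  have hcl : (↑(cl G v ∪ N2 G v) : Set V) = Set.univ := by
    apply closed_univ h.conn ⟨v, by simp⟩
    intro x hx y hxy
    by_contra hy
    simp only [coe_union, Set.mem_union, mem_coe, not_or] at hx hy
    rcases hx with hx | hx
    · rcases mem_cl.1 hx with rfl | hx
      · exact hy.1 (by simp [hxy])
      · exact hy.2 (mem_N2.2 ⟨fun e => hy.1 (by simp [e]), fun e => hy.1 (by simp [e]), x, hx, hxy⟩)
    · have : x ∈ outer G v := mem_outer.2 ⟨hx, y, hxy, hy⟩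
      simp [hne] at this
  have hcl' : cl G v ∪ N2 G v = univ := by rw [← coe_inj, hcl, coe_univ]
  obtain ⟨x, y, hxy, ha, hn⟩ := h.diam
  apply hn
  have hc : (univ : Finset V).card ≤ d + 4 := by
    rw [← hcl']; exact (card_union_le _ _).trans (by rw [cl_card h.reg]; omega)
  have h1 := nonnb_card h.reg (mem_univ x)
  have h2 := nonnb_card h.reg (mem_univ y)
  have h9 := h.deg
  rw [sdiff_eq_empty_iff_subset.2 (subset_univ _), card_empty] at h1 h2
  exact common_nb (mem_univ _) (mem_univ _) hxy ha (by omega)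

/-- Let `a` be a common neighbour of `v` and `x`, and `y` a neighbour of `x` at distance three from
`v`. Then `x` reaches through `a` nearly all of `cl G v`, and through `y` the neighbours of `y`;
these sets are disjoint. What is lost to adjacency with `x` lies inside `nb G v` on one side and
outside it on the other, so both losses together are at most `d`. -/
lemma outer_card (h : Ctx G d) {v x : V} (hs : (N2 G v).card ≤ 3) (hx : x ∈ outer G v) :
    d ≤ (N2 G x).card + 2 := by
  obtain ⟨hx2, y, hxy, hy1, hy2⟩ := mem_outer.1 hx
  obtain ⟨hxv, hvx, a, hva, hax⟩ := mem_N2.1 hx2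
  have hyN : ∀ z, G.Adj y z → z ∉ cl G v := by
    intro z hz hzc
    rcases mem_cl.1 hzc with rfl | hvz
    · exact hy1 (by simp [hz.symm])
    · exact hy2 (mem_N2.2 ⟨fun e => hy1 (by simp [e]), fun e => hy1 (by simp [e]), z, hvz, hz.symm⟩)
  have e1 : ((cl G a ∩ cl G v) \ nb G x) ∪ (nb G y \ cl G x) ⊆ N2 G x := by
    intro z hz
    simp only [mem_union, mem_sdiff, mem_inter, mem_cl, mem_nb, not_or] at hz
    rcases hz with ⟨⟨h1, h2⟩, h3⟩ | ⟨h1, h2, h3⟩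
    · have hza : z ≠ a := by rintro rfl; exact h3 hax.symm
      refine mem_N2.2 ⟨?_, h3, a, hax.symm, h1.resolve_left hza⟩
      rintro rfl
      rcases h2 with h2 | h2
      · exact hxv h2
      · exact hvx h2
    · exact mem_N2.2 ⟨h2, h3, y, hxy, h1⟩
  have e2 : Disjoint ((cl G a ∩ cl G v) \ nb G x) (nb G y \ cl G x) := by
    rw [disjoint_left]; intro z h1 h2
    simp only [mem_sdiff, mem_inter, mem_nb] at h1 h2
    exact hyN z h2.1 h1.1.2
  have e3 : d + 1 ≤ (cl G a ∩ cl G v).card + 3 := by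
    rw [← cl_card h.reg a, ← card_inter_add_card_sdiff (cl G a) (cl G v)]
    have : cl G a \ cl G v ⊆ N2 G v := by
      intro z hz
      simp only [mem_sdiff, mem_cl, not_or] at hz
      have hza : z ≠ a := by rintro rfl; exact hz.2.2 hva
      exact mem_N2.2 ⟨hz.2.1, hz.2.2, a, hva, hz.1.resolve_left hza⟩
    have := card_le_card this
    omega
  have e4 : (cl G a ∩ cl G v).card ≤ ((cl G a ∩ cl G v) \ nb G x).card + (nb G x ∩ nb G v).card := by
    rw [← card_sdiff_add_card_inter (cl G a ∩ cl G v) (nb G x)]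
    refine Nat.add_le_add_left (card_le_card fun z hz => ?_) _
    simp only [mem_inter, mem_cl, mem_nb] at hz ⊢
    refine ⟨hz.2, hz.1.2.resolve_left ?_⟩
    rintro rfl; exact hvx hz.2.symm
  have e5 : d ≤ (nb G y \ cl G x).card + (nb G y ∩ cl G x).card := by
    rw [add_comm, card_inter_add_card_sdiff, h.reg]
  have e6 : (nb G y ∩ cl G x).card + (nb G x ∩ nb G v).card ≤ d := by
    have f1 : nb G y ∩ cl G x ⊆ insert x ((nb G x \ nb G v).erase y) := by
      intro z hz
      simp only [mem_inter, mem_cl, mem_nb, mem_insert, mem_erase, mem_sdiff] at hz ⊢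
      rcases hz.2 with h' | h'
      · exact Or.inl h'
      · exact Or.inr ⟨fun e => by subst e; exact G.loopless.irrefl _ hz.1, h',
          fun e => hyN z hz.1 (by simp [e])⟩
    have f2 := (card_le_card f1).trans (card_insert_le _ _)
    have f3 : y ∈ nb G x \ nb G v := by
      simp only [mem_sdiff, mem_nb]; exact ⟨hxy, fun e => hy1 (by simp [e])⟩
    rw [card_erase_of_mem f3] at f2
    have f4 := card_pos.2 ⟨y, f3⟩
    have f5 := nb_sdiff_card h.reg (nb G v) x
    omega
  have := card_le_card e1
  rw [card_union_of_disjoint e2] at this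
  omega

end Basic

/-! ### Tails and the vertices that withhold charge. -/

section Tails
open scoped Classical
open Finset
variable {V : Type*} [Fintype V] {G : SimpleGraph V} {d : ℕ}

lemma mem_nonnb_iff_compl {P : Finset V} {v y : V} :
    y ∈ nonnb G P v ↔ y ∈ P ∧ Gᶜ.Adj v y := by
  rw [mem_nonnb, SimpleGraph.compl_adj]; tauto

lemma mem_nonnb_comm {P : Finset V} {v y : V} (hv : v ∈ P) (hy : y ∈ nonnb G P v) :
    v ∈ nonnb G P y := by
  simp only [mem_nonnb] at *
  exact ⟨hv, hy.2.1.symm, fun h => hy.2.2 h.symm⟩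

lemma sdiff_empty_iff {P : Finset V} {v : V} :
    (nb G v \ P).card = 0 ↔ ∀ y, G.Adj v y → y ∈ P := by
  rw [card_eq_zero, sdiff_eq_empty_iff_subset]
  simp [subset_iff]

lemma coStar_facts (hreg : ∀ v, (nb G v).card = d) {R : Finset V} (hR : R.card = d + 2) {u : V}
    {S : Set V} (h : IsCoStarMatching G (↑R) u S) :
    u ∈ R ∧ (∀ v ∈ R, v ≠ u → ∀ y, G.Adj v y → y ∈ R) ∧ (nb G u \ R).card + 1 = S.ncard := by
  refine ⟨h.center_mem, ?_, ?_⟩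
  · intro v hv hvu
    rw [← sdiff_empty_iff]
    have h1 := nonnb_card hreg hv
    have : (nonnb G R v).card = 1 := by
      rw [card_eq_one]
      by_cases hS : v ∈ S
      · refine ⟨u, ?_⟩
        ext y
        rw [mem_nonnb_iff_compl, mem_singleton]
        constructor
        · rintro ⟨h1, h2⟩; exact (h.leaf_iff v hS y h1).1 h2
        · rintro rfl; exact ⟨h.center_mem, (h.leaf_iff v hS y h.center_mem).2 rfl⟩
      · obtain ⟨y, hy, hu⟩ := h.matching v hv hvu hS
        refine ⟨y, ?_⟩
        ext z
        rw [mem_nonnb_iff_compl, mem_singleton]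
        constructor
        · exact hu z
        · rintro rfl; exact hy
    omega
  · have h1 := nonnb_card hreg h.center_mem
    have : S = ↑(nonnb G R u) := by
      ext y
      rw [mem_coe, mem_nonnb_iff_compl]
      constructor
      · intro hy; exact ⟨h.leaves_subset hy, (h.center_iff y (h.leaves_subset hy)).2 hy⟩
      · rintro ⟨h1, h2⟩; exact (h.center_iff y h1).1 h2
    rw [this, Set.ncard_coe_finset]
    omega

lemma cliqueMinusEdge_facts (hreg : ∀ v, (nb G v).card = d) {R : Finset V} {a b : V}
    (h : IsCliqueMinusEdge G d (↑R) a b) :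
    (∀ v ∈ R, v ≠ a → v ≠ b → ∀ y, G.Adj v y → y ∈ R) ∧
      (nb G a \ R).card = 1 ∧ (nb G b \ R).card = 1 := by
  have hR : R.card = d + 1 := by rw [← h.ncard_eq, Set.ncard_coe_finset]
  refine ⟨?_, ?_, ?_⟩
  · intro v hv hva hvb
    rw [← sdiff_empty_iff]
    have h1 := nonnb_card hreg hv
    have : (nonnb G R v).card = 0 := by
      rw [card_eq_zero, eq_empty_iff_forall_notMem]
      intro y hy
      rw [mem_nonnb_iff_compl] at hy
      have := (h.compl_iff v hv y hy.1).1 hy.2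
      tauto
    omega
  · have h1 := nonnb_card hreg h.left_mem
    have : (nonnb G R a).card = 1 := by
      rw [card_eq_one]
      refine ⟨b, ?_⟩
      ext y
      rw [mem_nonnb_iff_compl, mem_singleton]
      constructor
      · rintro ⟨h2, h3⟩
        have := (h.compl_iff a h.left_mem y h2).1 h3
        have := h.ne
        tauto
      · rintro rfl; exact ⟨h.right_mem, (h.compl_iff _ h.left_mem _ h.right_mem).2 (by tauto)⟩
    omega
  · have h1 := nonnb_card hreg h.right_mem
    have : (nonnb G R b).card = 1 := by
      rw [card_eq_one]
      refine ⟨a, ?_⟩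
      ext y
      rw [mem_nonnb_iff_compl, mem_singleton]
      constructor
      · rintro ⟨h2, h3⟩
        have := (h.compl_iff b h.right_mem y h2).1 h3
        have := h.ne
        tauto
      · rintro rfl; exact ⟨h.left_mem, (h.compl_iff _ h.right_mem _ h.left_mem).2 (by tauto)⟩
    omega

/-- In a set of `d + 2` vertices, a vertex with no outside neighbour misses exactly one other
vertex. The complement is thus forced, once `u` is the only possible exit. -/
lemma coStar_mk (hreg : ∀ v, (nb G v).card = d) {R : Finset V} (hR : R.card = d + 2) {u : V}
    (hu : u ∈ R) (hcl : ∀ v ∈ R, v ≠ u → ∀ y, G.Adj v y → y ∈ R) :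
    IsCoStarMatching G (↑R) u (↑(nonnb G R u)) := by
  have key : ∀ v ∈ R, v ≠ u → ∃ y, nonnb G R v = {y} := by
    intro v hv hvu
    have h1 := nonnb_card hreg hv
    have h2 := sdiff_empty_iff.2 (hcl v hv hvu)
    rw [← card_eq_one]; omega
  refine ⟨hu, fun y hy => (mem_nonnb.1 hy).1, ?_, ?_, ?_⟩
  · intro y hy
    rw [mem_coe, mem_nonnb_iff_compl]
    exact ⟨fun h => ⟨hy, h⟩, fun h => h.2⟩
  · intro s hs y hy
    have hsR := (mem_nonnb.1 hs).1
    obtain ⟨z, hz⟩ := key s hsR (mem_nonnb.1 hs).2.1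
    have h1 := mem_nonnb_comm hu (mem_coe.1 hs)
    have h2 : Gᶜ.Adj s y ↔ y ∈ nonnb G R s := by
      rw [mem_nonnb_iff_compl]; exact ⟨fun h => ⟨hy, h⟩, fun h => h.2⟩
    rw [hz, mem_singleton] at h1
    rw [h2, hz, h1, mem_singleton]
  · intro x hx hxu _
    obtain ⟨z, hz⟩ := key x hx hxu
    have h2 : ∀ y, y ∈ R ∧ Gᶜ.Adj x y ↔ y = z := by
      intro y; rw [← mem_nonnb_iff_compl, hz, mem_singleton]
    exact ⟨z, (h2 z).2 rfl, fun y hy => (h2 y).1 hy⟩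

lemma isTail_of_closed (hreg : ∀ v, (nb G v).card = d) {R : Finset V} (hR : R.card = d + 2)
    {w : V} (hw : w ∈ R) (hcl : ∀ v ∈ R, v ≠ w → ∀ y, G.Adj v y → y ∈ R)
    (h1 : (nb G w \ R).card = 1) : IsTail G d (↑R) w := by
  refine IsTail.base _ _ ⟨by rw [Set.ncard_coe_finset, hR], _, ?_, coStar_mk hreg hR hw hcl⟩
  rw [Set.ncard_coe_finset]
  have := nonnb_card hreg hw
  omega

lemma cliqueMinusEdge_mk (hreg : ∀ v, (nb G v).card = d) {C : Finset V} (hC : C.card = d + 1)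
    {a b : V} (ha : a ∈ C) (hb : b ∈ C) (hab : a ≠ b) (h1 : (nb G a \ C).card = 1)
    (h2 : (nb G b \ C).card = 1)
    (hcl : ∀ v ∈ C, v ≠ a → v ≠ b → ∀ y, G.Adj v y → y ∈ C) :
    IsCliqueMinusEdge G d (↑C) a b := by
  have h0 : ∀ v ∈ C, v ≠ a → v ≠ b → nonnb G C v = ∅ := by
    intro v hv hva hvb
    have h3 := nonnb_card hreg hv
    have h4 := sdiff_empty_iff.2 (hcl v hv hva hvb)
    rw [← card_eq_zero]; omega
  have h5 : nonnb G C a = {b} := by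
    have h3 := nonnb_card hreg ha
    obtain ⟨y, hy⟩ := card_eq_one.1 (show (nonnb G C a).card = 1 by omega)
    have hya : y ∈ nonnb G C a := by simp [hy]
    have := mem_nonnb_comm ha hya
    by_cases hyb : y = b
    · rw [hy, hyb]
    · rw [h0 y (mem_nonnb.1 hya).1 (mem_nonnb.1 hya).2.1 hyb] at this
      simp at this
  have h6 : nonnb G C b = {a} := by
    have h3 := nonnb_card hreg hb
    obtain ⟨y, hy⟩ := card_eq_one.1 (show (nonnb G C b).card = 1 by omega)
    have := mem_nonnb_comm ha (show b ∈ nonnb G C a by simp [h5])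
    rw [hy, mem_singleton] at this
    rw [hy, this]
  refine ⟨by rw [Set.ncard_coe_finset, hC], ha, hb, hab, ?_⟩
  intro x hx y hy
  have h7 : Gᶜ.Adj x y ↔ y ∈ nonnb G C x := by
    rw [mem_nonnb_iff_compl]; exact ⟨fun h => ⟨hy, h⟩, fun h => h.2⟩
  rw [h7]
  by_cases hxa : x = a
  · subst hxa; rw [h5, mem_singleton]; tauto
  by_cases hxb : x = b
  · subst hxb; rw [h6, mem_singleton]; tauto
  rw [h0 x hx hxa hxb]; simp [hxa, hxb]

/-- The degree sum inside `R` is `d(d+1) + (d-1)`, and it must be even. -/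
lemma odd_of_coStar (hreg : ∀ v, (nb G v).card = d) {R : Finset V} (hR : R.card = d + 2) {u : V}
    (hu : u ∈ R) (hcl : ∀ v ∈ R, v ≠ u → ∀ y, G.Adj v y → y ∈ R)
    (h1 : (nb G u \ R).card = 1) : Odd d := by
  have h2 := even_sum_inter (G := G) R
  rw [← add_sum_erase _ _ hu] at h2
  have h3 : ∀ v ∈ R.erase u, (nb G v ∩ R).card = d := by
    intro v hv
    have h4 := nb_sdiff_card hreg R v
    have h5 := sdiff_empty_iff.2 (hcl v (mem_of_mem_erase hv) (ne_of_mem_erase hv))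
    omega
  rw [sum_congr rfl h3, sum_const, card_erase_of_mem hu, hR, smul_eq_mul] at h2
  have h4 := nb_sdiff_card hreg R u
  obtain ⟨e, rfl⟩ : ∃ e, d = e + 1 := ⟨(nb G u ∩ R).card, by omega⟩
  have h5 : (nb G u ∩ R).card = e := by omega
  rw [h5] at h2
  rw [← Nat.not_even_iff_odd]
  intro he
  simp only [Nat.even_add, Nat.even_mul, Nat.even_add_one] at h2 he
  revert h2; simp [Nat.even_add_one, he]

/-- All that is ever used of a tail: a single edge leaves it, at its end vertex, and its B region
forces `d` to be odd. -/
lemma tail_facts (hreg : ∀ v, (nb G v).card = d) {T : Set V} {w : V} (hT : IsTail G d T w) :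
    w ∈ T ∧ (∀ v ∈ T, v ≠ w → ∀ y, G.Adj v y → y ∈ T) ∧
      (∃ z, z ∉ T ∧ G.Adj w z ∧ ∀ y, y ∉ T → G.Adj w y → y = z) ∧ Odd d := by
  have hone : ∀ {P : Finset V} {w : V}, (nb G w \ P).card = 1 →
      ∃ z, z ∉ (↑P : Set V) ∧ G.Adj w z ∧ ∀ y, y ∉ (↑P : Set V) → G.Adj w y → y = z := by
    intro P w h
    obtain ⟨z, hz⟩ := card_eq_one.1 h
    have hm : ∀ y, G.Adj w y ∧ y ∉ P ↔ y = z := by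
      intro y; rw [← mem_singleton, ← hz]; simp
    exact ⟨z, ((hm z).2 rfl).2, ((hm z).2 rfl).1, fun y h1 h2 => (hm y).1 ⟨h2, h1⟩⟩
  induction hT with
  | base R w hB =>
    obtain ⟨hc, S, hS, hco⟩ := hB
    lift R to Finset V using Set.toFinite R
    rw [Set.ncard_coe_finset] at hc
    obtain ⟨h1, h2, h3⟩ := coStar_facts hreg hc hco
    have h4 : (nb G w \ R).card = 1 := by omega
    exact ⟨h1, h2, hone h4, odd_of_coStar hreg hc h1 h2 h4⟩
  | step T w R a b hT hdis hR hadj ih =>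
    obtain ⟨h1, h2, ⟨z, hz, hwz, hu⟩, hodd⟩ := ih
    lift R to Finset V using Set.toFinite R
    obtain ⟨h3, h4, h5⟩ := cliqueMinusEdge_facts hreg hR
    have hwa : G.Adj w a := (hadj w h1 a hR.left_mem).2 ⟨rfl, rfl⟩
    have haT : a ∉ T := fun h => Set.disjoint_left.1 hdis h hR.left_mem
    obtain ⟨x, hx, hbx, hxu⟩ := hone h5
    obtain ⟨x', hx', hax', hxu'⟩ := hone h4
    have hwR : w ∉ (↑R : Set V) := fun h => Set.disjoint_left.1 hdis h1 h
    refine ⟨Or.inr hR.right_mem, ?_, ⟨x, ?_, hbx, ?_⟩, hodd⟩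
    · rintro v (hv | hv) hvb y hy
      · by_cases hvw : v = w
        · subst hvw
          by_cases hyT : y ∈ T
          · exact Or.inl hyT
          · rw [hu y hyT hy, ← hu a haT hwa]; exact Or.inr hR.left_mem
        · exact Or.inl (h2 v hv hvw y hy)
      · by_cases hva : v = a
        · subst hva
          by_cases hyR : y ∈ (↑R : Set V)
          · exact Or.inr hyR
          · rw [hxu' y hyR hy, ← hxu' w hwR hwa.symm]; exact Or.inl h1
        · exact Or.inr (h3 v hv hva hvb y hy)
    · rintro (h | h)
      · exact hR.ne.symm ((hadj x h b hR.right_mem).1 hbx.symm).2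
      · exact hx h
    · intro y hy hby
      exact hxu y (fun h => hy (Or.inr h)) hby

/-- `forb G d x u`: the vertex `x` is the end of a tail that does not contain `u`. -/
def forb (G : SimpleGraph V) (d : ℕ) (x u : V) : Prop := ∃ T, IsTail G d T x ∧ u ∉ T

/-- `res G x`: the vertex `x` has a neighbour with a single vertex at distance two. -/
def res (G : SimpleGraph V) (x : V) : Prop := ∃ l, G.Adj x l ∧ (N2 G l).card = 1

/-- The vertices that are to give charge to `u`. -/
noncomputable def donors (G : SimpleGraph V) (d : ℕ) (u : V) : Finset V :=
  (outer G u).filter fun x => ¬ forb G d x u ∧ ¬ res G x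

lemma mem_donors {u x : V} :
    x ∈ donors G d u ↔ x ∈ outer G u ∧ ¬ forb G d x u ∧ ¬ res G x := by simp [donors]

/-- A tail with end `x` that avoids the ball of radius two around `u` except for `x`. -/
structure TailAt (G : SimpleGraph V) (d : ℕ) (x u : V) (T : Set V) (z : V) : Prop where
  tail : IsTail G d T x
  odd : Odd d
  mem : x ∈ T
  closed : ∀ v ∈ T, v ≠ x → ∀ y, G.Adj v y → y ∈ T
  notMem : z ∉ T
  adj : G.Adj x z
  unique : ∀ y, y ∉ T → G.Adj x y → y = z
  adj' : G.Adj u z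
  cl_disj : ∀ y ∈ cl G u, y ∉ T
  N2_disj : ∀ y ∈ N2 G u, y ≠ x → y ∉ T

lemma forb.tailAt (hreg : ∀ v, (nb G v).card = d) {x u : V} (h : forb G d x u)
    (hx : x ∈ N2 G u) : ∃ T z, TailAt G d x u T z := by
  obtain ⟨T, hT, hu⟩ := h
  obtain ⟨h1, h2, ⟨z, h3, h4, h5⟩, h6⟩ := tail_facts hreg hT
  obtain ⟨hxu, hux, a, ha, hax⟩ := mem_N2.1 hx
  have hcl : ∀ y ∈ cl G u, y ∉ T := by
    intro y hy hyT
    rcases mem_cl.1 hy with rfl | hy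
    · exact hu hyT
    · exact hu (h2 y hyT (by rintro rfl; exact hux hy) u hy.symm)
  have haz : a = z := h5 a (hcl a (by simp [ha])) hax.symm
  refine ⟨T, z, hT, h6, h1, h2, h3, h4, h5, haz ▸ ha, hcl, ?_⟩
  intro y hy hyx hyT
  obtain ⟨-, -, b, hb, hby⟩ := mem_N2.1 hy
  exact hcl b (by simp [hb]) (h2 y hyT hyx b hby.symm)

lemma TailAt.inter_eq {x u z : V} {T : Set V} (h : TailAt G d x u T z) {W : Finset V}
    (hW : ∀ y ∈ W, y ∉ T) (hz : z ∈ W) : nb G x ∩ W = {z} := by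
  ext y
  simp only [mem_inter, mem_nb, mem_singleton]
  constructor
  · rintro ⟨h1, h2⟩; exact h.unique y (hW y h2) h1
  · rintro rfl; exact ⟨h.adj, hz⟩

/-- The edge `xz` is a bridge, so each end sees all other neighbours of the opposite end at distance
two. -/
lemma TailAt.card_end (hreg : ∀ v, (nb G v).card = d) {x u z : V} {T : Set V}
    (h : TailAt G d x u T z) : d ≤ (N2 G x).card + 1 ∧ d ≤ (N2 G z).card + 1 := by
  have h1 : (nb G z).erase x ⊆ N2 G x := by
    intro y hy
    simp only [mem_erase, mem_nb] at hy
    refine mem_N2.2 ⟨hy.1, fun hxy => ?_, z, h.adj, hy.2⟩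
    by_cases hyT : y ∈ T
    · exact h.notMem (h.closed y hyT hy.1 z hy.2.symm)
    · have := h.unique y hyT hxy; subst this; exact G.loopless.irrefl _ hy.2
  have h2 : (nb G x).erase z ⊆ N2 G z := by
    intro y hy
    simp only [mem_erase, mem_nb] at hy
    refine mem_N2.2 ⟨hy.1, fun hzy => ?_, x, h.adj.symm, hy.2⟩
    by_cases hyT : y ∈ T
    · exact h.notMem (h.closed y hyT (fun e => G.loopless.irrefl _ (e ▸ hy.2)) z hzy.symm)
    · exact hy.1 (h.unique y hyT hy.2)
  have h3 := card_le_card h1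
  have h4 := card_le_card h2
  rw [card_erase_of_mem (by simp [h.adj.symm]), hreg] at h3
  rw [card_erase_of_mem (by simp [h.adj]), hreg] at h4
  omega

end Tails

/-! ### Sets attached at a cut vertex, and the peanut graph. -/

section Cuts
open scoped Classical
open Finset
variable {V : Type*} [Fintype V] {G : SimpleGraph V} {d : ℕ}

/-- All edges that leave `P` go to the vertex `q`. -/
structure Cut (G : SimpleGraph V) (P : Finset V) (q : V) : Prop where
  notMem : q ∉ P
  out : ∀ v ∈ P, ∀ y, G.Adj v y → y ∈ P ∨ y = q

namespace Cut
variable {P : Finset V} {q u c c' : V}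

lemma not_adj (h : Cut G P q) (hu : u ∉ P) (hq : u ≠ q) (hc : c ∈ P) : ¬ G.Adj u c :=
  fun ha => (h.out c hc u ha.symm).elim hu hq

lemma cl_disj (h : Cut G P q) (hu : u ∉ P) (hq : u ≠ q) : ∀ y ∈ cl G u, y ∉ P := by
  intro y hy hyP
  rcases mem_cl.1 hy with rfl | hy
  · exact hu hyP
  · exact h.not_adj hu hq hyP hy

lemma sub_N2 (h : Cut G P q) (hu : u ∉ P) (hqu : G.Adj q u) : nb G q ∩ P ⊆ N2 G u := by
  intro y hy
  simp only [mem_inter, mem_nb] at hy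
  exact mem_N2.2 ⟨fun e => hu (e ▸ hy.2), h.not_adj hu hqu.ne.symm hy.2, q, hqu.symm, hy.1⟩

lemma N2_inter (h : Cut G P q) (hu : u ∉ P) (hq : u ≠ q) : ∀ y ∈ N2 G u, y ∈ P → G.Adj q y := by
  intro y hy hyP
  obtain ⟨-, -, b, h1, h2⟩ := mem_N2.1 hy
  rcases h.out y hyP b h2.symm with h3 | rfl
  · exact absurd h1 (h.not_adj hu hq h3)
  · exact h2

/-- Paths from `u` into `P` pass through `q`, so `c'` is farther than two from `u` and witnesses
that `c` is outer. -/
lemma mem_outer (h : Cut G P q) (hu : u ∉ P) (hqu : G.Adj q u) (hc : c ∈ P) (hcq : G.Adj q c)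
    (hc' : c' ∈ P) (hcc : G.Adj c c') (hcq' : ¬ G.Adj q c') : c ∈ outer G u := by
  refine RegularSquare.mem_outer.2 ⟨h.sub_N2 hu hqu (by simp [hc, hcq]), c', hcc, ?_, ?_⟩
  · exact fun h' => h.cl_disj hu hqu.ne.symm _ h' hc'
  · exact fun h' => hcq' (h.N2_inter hu hqu.ne.symm _ h' hc')

lemma adj_of_N2 (h : Cut G P q) (hc : c ∈ P) (hu : u ∈ N2 G c) (huP : u ∉ P) (hq : u ≠ q) :
    G.Adj q u := by
  obtain ⟨-, -, b, h1, h2⟩ := mem_N2.1 hu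
  rcases h.out c hc b h1 with h3 | rfl
  · exact absurd h2.symm (h.not_adj huP hq h3)
  · exact h2

lemma sdiff_sub_N2 (h : Cut G P q) (hc : c ∈ P) (hcq : G.Adj q c) : nb G q \ P ⊆ N2 G c := by
  intro y hy
  simp only [mem_sdiff, mem_nb] at hy
  refine mem_N2.2 ⟨fun e => hy.2 (e ▸ hc), fun ha => ?_, q, hcq.symm, hy.1⟩
  rcases h.out c hc y ha with h1 | rfl
  · exact hy.2 h1
  · exact G.loopless.irrefl _ hy.1

lemma sdiff_eq (h : Cut G P q) (hc : c ∈ P) (hcq : G.Adj q c) : nb G c \ P = {q} := by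
  ext y
  simp only [mem_sdiff, mem_nb, mem_singleton]
  constructor
  · rintro ⟨h1, h2⟩; exact (h.out c hc y h1).resolve_left h2
  · rintro rfl; exact ⟨hcq.symm, h.notMem⟩

lemma nb_sub (h : Cut G P q) (hc : c ∈ P) (hcq : ¬ G.Adj q c) : ∀ y, G.Adj c y → y ∈ P := by
  intro y hy
  rcases h.out c hc y hy with h1 | rfl
  · exact h1
  · exact absurd hy.symm hcq

/-- A neighbour of the cut vertex sees at distance two something other than the neighbours of the
cut vertex in `P`. -/
lemma not_N2_subset (h : Cut G P q) (hreg : ∀ v, (nb G v).card = d) (hu : u ∉ P)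
    (hqu : G.Adj q u) (hc : c ∈ P) (hcq : G.Adj q c) : ¬ N2 G u ⊆ nb G q ∩ P := by
  intro hsub
  have hd := h.cl_disj hu hqu.ne.symm
  have hq : q ∈ cl G u := by simp [hqu.symm]
  -- Only `q` can lead from `cl G u` into `P`, so any other `y` has all its `d` neighbours in `cl G
  -- u`, including `q`. Together with `c` this gives `q` too many neighbours.
  have key : ∀ y ∈ cl G u, y ≠ q → G.Adj q y := by
    intro y hy hyq
    have h1 : nb G y ⊆ (cl G u).erase y := by
      intro z hz
      rw [mem_nb] at hz
      refine mem_erase.2 ⟨hz.ne.symm, ?_⟩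
      by_contra hzu
      have h2 : z ∈ N2 G u := by
        simp only [mem_cl, not_or] at hzu hy
        refine mem_N2.2 ⟨hzu.1, hzu.2, y, hy.resolve_left ?_, hz⟩
        rintro rfl; exact hzu.2 hz
      have h3 := (mem_inter.1 (hsub h2)).2
      exact (h.out z h3 y hz.symm).elim (hd y hy) hyq
    have h2 := eq_of_subset_of_card_le h1
      (by rw [card_erase_of_mem hy, cl_card hreg, hreg]; omega)
    have : q ∈ nb G y := by rw [h2]; exact mem_erase.2 ⟨hyq.symm, hq⟩
    exact (mem_nb.1 this).symm
  have h1 : insert c ((cl G u).erase q) ⊆ nb G q := by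
    intro y hy
    rcases mem_insert.1 hy with rfl | hy
    · simpa using hcq
    · rw [mem_nb]; exact key y (mem_of_mem_erase hy) (ne_of_mem_erase hy)
  have h2 := card_le_card h1
  rw [card_insert_of_notMem (fun h' => hd c (mem_of_mem_erase h') hc), card_erase_of_mem hq,
    cl_card hreg, hreg] at h2
  omega

end Cut

lemma cl_sub_ball {v c c' : V} (hc : c ∈ cl G v) (hc' : c' ∈ cl G v) :
    c' ∈ cl G c ∨ c' ∈ N2 G c := by
  by_cases h : c' ∈ cl G c
  · exact Or.inl h
  · right
    simp only [mem_cl, not_or] at h hc hc'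
    have h1 : G.Adj v c' := by
      refine hc'.resolve_left ?_
      rintro rfl
      rcases hc with rfl | hc
      · exact h.1 rfl
      · exact h.2 hc.symm
    have h2 : G.Adj v c := by
      refine hc.resolve_left ?_
      rintro rfl; exact h.2 h1
    exact mem_N2.2 ⟨h.1, h.2, v, h2.symm, h1⟩

/-- The closed neighbourhood of `l` is attached to the rest of the graph at the vertex `x` only. -/
structure Pend (G : SimpleGraph V) (d : ℕ) (l x : V) : Prop where
  N2_eq : N2 G l = {x}
  outer : x ∈ outer G l
  cut : Cut G (cl G l) x
  even : Even (nb G x ∩ cl G l).card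
  two_le : 2 ≤ (nb G x ∩ cl G l).card
  lt : (nb G x ∩ cl G l).card + 1 ≤ d
  big : ∀ c ∈ cl G l, G.Adj x c → d + 1 ≤ (N2 G c).card + (nb G x ∩ cl G l).card
  full : ∀ c ∈ cl G l, ¬ G.Adj x c → cl G c = cl G l

lemma mem_N2_of_adj {v y z : V} (hy : y ∈ cl G v) (hyz : G.Adj y z) :
    z ∈ cl G v ∨ z ∈ N2 G v := by
  by_cases h : z ∈ cl G v
  · exact Or.inl h
  · right
    simp only [mem_cl, not_or] at h hy
    refine mem_N2.2 ⟨h.1, h.2, y, hy.resolve_left ?_, hyz⟩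
    rintro rfl; exact h.2 hyz

lemma mem_of_notMem_outer {v y z : V} (hy : y ∈ N2 G v) (hy' : y ∉ outer G v) (hyz : G.Adj y z) :
    z ∈ cl G v ∨ z ∈ N2 G v := by
  by_contra h
  rw [not_or] at h
  exact hy' (mem_outer.2 ⟨hy, z, hyz, h⟩)

/-- Since `d(d+1)` is even, so is the number of edges from `x` to `cl G l`; hence there are at least
two. A neighbour of `x` in `cl G l` misses one vertex there and sees it, and the outside neighbours
of `x`, at distance two. -/
lemma exists_pend (h : Ctx G d) {l : V} (hl : (N2 G l).card = 1) : ∃ x, Pend G d l x := by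
  obtain ⟨x, hx⟩ := card_eq_one.1 hl
  have ho : x ∈ outer G l := by
    obtain ⟨y, hy⟩ := outer_nonempty h (v := l) (by omega)
    have := outer_subset _ hy
    rw [hx, mem_singleton] at this
    exact this ▸ hy
  have hxN := mem_N2.1 (outer_subset _ ho)
  have hcut : Cut G (cl G l) x := by
    refine ⟨by rw [mem_cl, not_or]; exact ⟨hxN.1, hxN.2.1⟩, ?_⟩
    intro v hv y hy
    have := mem_N2_of_adj hv hy
    rwa [hx, mem_singleton] at this
  have heven := even_boundary h.reg (W := cl G l) (X := {x}) (by simpa using hcut.notMem)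
    (by simpa using hcut.out)
  rw [sum_singleton, cl_card h.reg, Nat.even_add] at heven
  have he : Even (nb G x ∩ cl G l).card := heven.1 (Nat.even_mul_succ_self d)
  have hpos : 0 < (nb G x ∩ cl G l).card := by
    obtain ⟨-, -, y, h1, h2⟩ := hxN
    exact card_pos.2 ⟨y, by simp [h1, h2.symm]⟩
  have hsplit := nb_sdiff_card h.reg (cl G l) x
  refine ⟨x, hx, ho, hcut, he, ?_, ?_, ?_, ?_⟩
  · obtain ⟨k, hk⟩ := he; omega
  · obtain ⟨-, y, h1, h2, -⟩ := mem_outer.1 ho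
    have : 0 < (nb G x \ cl G l).card := card_pos.2 ⟨y, by rw [mem_sdiff, mem_nb]; exact ⟨h1, h2⟩⟩
    omega
  · intro c hc hxc
    have h1 := nonnb_card h.reg hc
    rw [hcut.sdiff_eq hc hxc, cl_card h.reg, card_singleton] at h1
    obtain ⟨m, hm⟩ := card_eq_one.1 (show (nonnb G (cl G l) c).card = 1 by omega)
    have hm' : m ∈ nonnb G (cl G l) c := by simp [hm]
    rw [mem_nonnb] at hm'
    have h2 : insert m (nb G x \ cl G l) ⊆ N2 G c := by
      intro y hy
      rcases mem_insert.1 hy with rfl | hy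
      · refine (cl_sub_ball hc hm'.1).resolve_left ?_
        rw [mem_cl, not_or]; exact hm'.2
      · exact hcut.sdiff_sub_N2 hc hxc hy
    have h3 := card_le_card h2
    rw [card_insert_of_notMem (fun h' => (mem_sdiff.1 h').2 hm'.1)] at h3
    omega
  · intro c hc hxc
    refine eq_of_subset_of_card_le ?_ (by rw [cl_card h.reg, cl_card h.reg])
    intro y hy
    rcases mem_cl.1 hy with rfl | hy
    · exact hc
    · exact hcut.nb_sub hc hxc y hy

namespace Pend
variable {l x : V}

lemma not_adj_self (hp : Pend G d l x) : ¬ G.Adj x l := by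
  intro ha
  have : x ∈ N2 G l := by simp [hp.N2_eq]
  exact (mem_N2.1 this).2.1 ha.symm

lemma cl_eq (hp : Pend G d l x) {m : V} (hm : m ∈ cl G l) (hs : (N2 G m).card = 1) :
    cl G m = cl G l := by
  apply hp.full m hm
  intro ha
  have := hp.big m hm ha
  have := hp.lt
  omega

lemma res_of_adj (hp : Pend G d l x) {c : V} (hc : c ∈ cl G l) (hxc : G.Adj x c) : res G c := by
  refine ⟨l, ?_, by simp [hp.N2_eq]⟩
  rcases mem_cl.1 hc with rfl | hc
  · exact absurd hxc hp.not_adj_self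
  · exact hc.symm

end Pend

/-- Being outer for `u` forces `u` to lie beyond the cut vertex `x`. Then all neighbours of `x` in
`cl G l` belong to `N2 G u`, and their number is even, positive and at most three. -/
lemma res_struct (h : Ctx G d) {x' u : V} (hres : res G x') (hx' : x' ∈ outer G u)
    (hu : (N2 G u).card ≤ 3) :
    ∃ l x, Pend G d l x ∧ u ∉ cl G l ∧ G.Adj x u ∧ x' ∈ nb G x ∩ cl G l ∧
      (nb G x ∩ cl G l).card = 2 := by
  obtain ⟨l, hl, hs⟩ := hres
  obtain ⟨x, hp⟩ := exists_pend h hs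
  have hx'C : x' ∈ cl G l := by simp [hl.symm]
  obtain ⟨hN, y, hy1, hy2, hy3⟩ := mem_outer.1 hx'
  have hN' := mem_N2.1 hN
  have huC : u ∉ cl G l := by
    intro huC
    have hyC : y ∉ cl G l := fun hyC => (cl_sub_ball huC hyC).elim hy2 hy3
    have hyx := (hp.cut.out x' hx'C y hy1).resolve_left hyC
    subst hyx
    have hnu : ¬ G.Adj y u := fun h' => hy2 (by simp [h'.symm])
    have := hp.full u huC hnu
    rw [← this, mem_cl] at hx'C
    tauto
  have hux : u ≠ x := by
    rintro rfl
    have hyC : y ∈ cl G l := (hp.cut.out x' hx'C y hy1).resolve_right (fun e => hy2 (by simp [e]))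
    obtain ⟨c, hc⟩ := card_pos.1 (lt_of_lt_of_le two_pos hp.two_le)
    simp only [mem_inter, mem_nb] at hc
    have hny : ¬ G.Adj u y := fun h' => hy2 (by simp [h'])
    have h1 := hc.2
    rw [← hp.full y hyC hny, mem_cl] at h1
    have h2 : G.Adj y c := h1.resolve_left (by rintro rfl; exact hny hc.1)
    exact hy3 (mem_N2.2 ⟨fun e => huC (e ▸ hyC), hny, c, hc.1, h2.symm⟩)
  have hxu : G.Adj x u := hp.cut.adj_of_N2 hx'C (N2_comm.1 hN) huC hux
  have hsub := hp.cut.sub_N2 huC hxu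
  have hle := card_le_card hsub
  refine ⟨l, x, hp, huC, hxu, ?_, ?_⟩
  · rw [mem_inter, mem_nb]; exact ⟨hp.cut.N2_inter huC hux _ hN hx'C, hx'C⟩
  · obtain ⟨k, hk⟩ := hp.even
    have := hp.two_le
    omega

/-- Abstention by a `res` vertex never leaves `u` without a donor: by `not_N2_subset` there is a
third vertex `p` in `N2 G u`, and `p` pays unless the graph is a peanut. -/
lemma res_outer (h : Ctx G d) {x' u : V} (hres : res G x') (hx' : x' ∈ outer G u)
    (hu : (N2 G u).card ≤ 3) : (N2 G u).card = 3 ∧ (donors G d u).Nonempty := by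
  obtain ⟨l, x, hp, huC, hxu, hx'A, hA⟩ := res_struct h hres hx' hu
  have hsub := hp.cut.sub_N2 huC hxu
  have hle := card_le_card hsub
  have hx'A' := mem_inter.1 hx'A
  rw [mem_nb] at hx'A'
  have h3 : (N2 G u).card = 3 := by
    by_contra hne
    have : N2 G u = nb G x ∩ cl G l := (eq_of_subset_of_card_le hsub (by omega)).symm
    exact hp.cut.not_N2_subset h.reg huC hxu hx'A'.2 hx'A'.1 this.subset
  refine ⟨h3, ?_⟩
  have hcld := hp.cut.cl_disj huC hxu.ne.symm
  obtain ⟨p, hpp⟩ : ∃ p, N2 G u \ (nb G x ∩ cl G l) = {p} := by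
    rw [← card_eq_one, card_sdiff_of_subset hsub]; omega
  have hpm : p ∈ N2 G u ∧ p ∉ nb G x ∩ cl G l := by
    rw [← mem_sdiff, hpp, mem_singleton]
  have hN2 : ∀ y ∈ N2 G u, y ∈ nb G x ∩ cl G l ∨ y = p := by
    intro y hy
    by_cases hyA : y ∈ nb G x ∩ cl G l
    · exact Or.inl hyA
    · right; rw [← mem_singleton, ← hpp, mem_sdiff]; exact ⟨hy, hyA⟩
  have hpC : p ∉ cl G l := fun hpC => hpm.2 (by
    rw [mem_inter, mem_nb]; exact ⟨hp.cut.N2_inter huC hxu.ne.symm p hpm.1 hpC, hpC⟩)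
  by_cases hpo : p ∈ outer G u
  · refine ⟨p, mem_donors.2 ⟨hpo, ?_, ?_⟩⟩
    · intro hf
      obtain ⟨T, z, hT⟩ := hf.tailAt h.reg hpm.1
      -- If `p` ended a tail, each of the three second neighbours would send one edge into `cl G u`,
      -- but `d(d+1) + 3` is odd.
      have hev := even_boundary h.reg (W := cl G u) (X := N2 G u)
        (by rw [disjoint_left]; intro y hy hy'; rw [mem_cl] at hy; have := mem_N2.1 hy'; tauto)
        (fun v hv y hy => mem_N2_of_adj hv hy)
      have h1 : ∀ y ∈ N2 G u, (nb G y ∩ cl G u).card = 1 := by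
        intro y hy
        rw [card_eq_one]
        rcases hN2 y hy with hyA | rfl
        · refine ⟨x, ?_⟩
          simp only [mem_inter, mem_nb] at hyA
          ext w
          simp only [mem_inter, mem_nb, mem_singleton]
          constructor
          · rintro ⟨h1, h2⟩; exact (hp.cut.out y hyA.2 w h1).resolve_left (hcld w h2)
          · rintro rfl; exact ⟨hyA.1.symm, by simp [hxu.symm]⟩
        · exact ⟨z, hT.inter_eq hT.cl_disj (by simp [hT.adj'])⟩
      rw [sum_congr rfl h1, sum_const, h3, cl_card h.reg, Nat.even_add] at hev
      have := hev.1 (Nat.even_mul_succ_self d)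
      revert this; decide
    · intro hr
      obtain ⟨l2, x2, hp2, huC2, hxu2, hpA2, hA2⟩ := res_struct h hr hpo hu
      have hsub2 := hp2.cut.sub_N2 huC2 hxu2
      -- Two pairs in a set of three meet. A common vertex makes the two pendant neighbourhoods
      -- equal, which would place `p` in the first pair.
      obtain ⟨c, hc⟩ : ((nb G x2 ∩ cl G l2) ∩ (nb G x ∩ cl G l)).Nonempty := by
        apply inter_nonempty_of_card_lt_card_add_card hsub2 hsub; omega
      simp only [mem_inter, mem_nb] at hc
      have hl2c : G.Adj c l2 := by
        rcases mem_cl.1 hc.1.2 with e | e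
        · exact absurd (e ▸ hc.1.1) hp2.not_adj_self
        · exact e.symm
      have hs2 : (N2 G l2).card = 1 := by simp [hp2.N2_eq]
      rcases hp.cut.out c hc.2.2 l2 hl2c with h4 | rfl
      · have h5 := hp.cl_eq h4 hs2
        have h6 : x2 = x := by
          refine (hp.cut.out c hc.2.2 x2 hc.1.1.symm).resolve_left ?_
          rw [← h5]; exact hp2.cut.notMem
        rw [h5, h6] at hpA2
        exact hpm.2 hpA2
      · have := outer_card h (by simp [hp.N2_eq]) hp.outer
        have := h.deg
        omega
  -- If `p` is not outer, `x` is the only exit of `cl G u ∪ {p}`, and this set and `cl G l` are the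
  -- two halves of a peanut graph.
  · exfalso
    apply h.not_peanut
    obtain ⟨w₁, w₂, hw, hAe⟩ := card_eq_two.1 hA
    have hmA : ∀ y, (G.Adj x y ∧ y ∈ cl G l) ↔ y = w₁ ∨ y = w₂ := by
      intro y
      rw [← mem_nb, ← mem_inter, hAe, mem_insert, mem_singleton]
    have hw1 := (hmA w₁).2 (Or.inl rfl)
    have hw2 := (hmA w₂).2 (Or.inr rfl)
    have hpu : p ∉ cl G u := by
      have := mem_N2.1 hpm.1
      rw [mem_cl]; tauto
    have hpx : p ≠ x := by rintro rfl; exact (mem_N2.1 hpm.1).2.1 hxu.symm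
    have hR2 : (insert p (cl G u)).card = d + 2 := by
      rw [card_insert_of_notMem hpu, cl_card h.reg]
    have hxR : x ∈ insert p (cl G u) := by simp [hxu.symm]
    have hdis : ∀ y ∈ insert p (cl G u), y ∉ cl G l := by
      intro y hy
      rcases mem_insert.1 hy with rfl | hy
      · exact hpC
      · exact hcld y hy
    have hstep : ∀ v ∈ insert p (cl G u), ∀ y, G.Adj v y →
        y ∈ insert p (cl G u) ∨ y ∈ nb G x ∩ cl G l := by
      intro v hv y hy
      have : y ∈ cl G u ∨ y ∈ N2 G u := by
        rcases mem_insert.1 hv with rfl | hv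
        · exact mem_of_notMem_outer hpm.1 hpo hy
        · exact mem_N2_of_adj hv hy
      rcases this with h1 | h1
      · exact Or.inl (mem_insert_of_mem h1)
      · rcases hN2 y h1 with h2 | rfl
        · exact Or.inr h2
        · exact Or.inl (mem_insert_self _ _)
    have hcl : ∀ v ∈ insert p (cl G u), v ≠ x → ∀ y, G.Adj v y → y ∈ insert p (cl G u) := by
      intro v hv hvx y hy
      refine (hstep v hv y hy).resolve_right fun h1 => ?_
      have h1 := (mem_inter.1 h1).2
      exact (hp.cut.out y h1 v hy.symm).elim (hdis v hv) hvx
    have hsd : nb G x \ insert p (cl G u) = nb G x ∩ cl G l := by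
      ext y
      constructor
      · intro hy
        rw [mem_sdiff, mem_nb] at hy
        exact (hstep x hxR y hy.1).resolve_left hy.2
      · intro hy
        rw [mem_inter] at hy
        exact mem_sdiff.2 ⟨hy.1, fun h' => hdis y h' hy.2⟩
    have hco := coStar_mk h.reg hR2 hxR hcl
    refine ⟨↑(cl G l), ↑(insert p (cl G u)), w₁, w₂, x, _, ?_, ?_, ?_, ?_, ?_, hco, ?_⟩
    · rw [Set.disjoint_left]; intro y hy hy'; exact hdis y hy' hy
    · apply closed_univ h.conn ⟨u, by simp⟩
      rintro v (hv | hv) y hy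
      · rcases hp.cut.out v hv y hy with h1 | rfl
        · exact Or.inl h1
        · exact Or.inr hxR
      · rcases hstep v hv y hy with h1 | h1
        · exact Or.inr h1
        · exact Or.inl (mem_inter.1 h1).2
    · refine cliqueMinusEdge_mk h.reg (cl_card h.reg l) hw1.2 hw2.2 hw ?_ ?_ ?_
      · rw [hp.cut.sdiff_eq hw1.2 hw1.1, card_singleton]
      · rw [hp.cut.sdiff_eq hw2.2 hw2.1, card_singleton]
      · intro v hv h1 h2
        apply hp.cut.nb_sub hv
        intro h3
        have := (hmA v).1 ⟨h3, hv⟩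
        tauto
    · rw [Set.ncard_coe_finset, hR2]
    · rw [Set.ncard_coe_finset]
      have := nonnb_card h.reg hxR
      rw [hsd, hA, hR2] at this
      omega
    · intro v hv y hy
      constructor
      · intro ha
        have hyx := (hp.cut.out v hv y ha).resolve_left (hdis y hy)
        subst hyx
        exact ⟨(hmA v).1 ⟨ha.symm, hv⟩, rfl⟩
      · rintro ⟨h1, rfl⟩
        exact ((hmA v).2 h1).1.symm

end Cuts

/-! ### The discharging rules and vertices with at least three second neighbours. -/

section Charge
open scoped Classical
open Finset
variable {V : Type*} [Fintype V] {G : SimpleGraph V} {d : ℕ}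

/-- The charge that every vertex is to end up with. -/
noncomputable def tau (d : ℕ) : ℝ := 4 - 20 / d

/-- The standard amount of charge sent to a vertex at distance two. -/
noncomputable def alpha (d : ℕ) : ℝ := 1 - 4 / ((d : ℝ) - 2)

/-- The charge that `x` sends to `u`. -/
noncomputable def gift (G : SimpleGraph V) (d : ℕ) (x u : V) : ℝ :=
  if x ∈ donors G d u then
    if (N2 G u).card = 1 then
      if (nb G x ∩ cl G u).card + 1 = d then tau d - 1 else alpha d
    else if (N2 G u).card = 2 then alpha d
    else if (N2 G u).card = 3 then alpha d / (donors G d u).card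
    else 0
  else 0

/-- The charge of `v` after charge has been sent to vertices at distance two. -/
noncomputable def ch (G : SimpleGraph V) (d : ℕ) (v : V) : ℝ :=
  (N2 G v).card + ∑ x, gift G d x v - ∑ u, gift G d v u

/-- The vertices that receive the remaining excess charge of `c`. -/
noncomputable def recv (G : SimpleGraph V) (c : V) : Finset V :=
  univ.filter fun v => (N2 G v).card ≤ 2 ∧ (G.Adj c v ∨ (c ∈ N2 G v ∧ c ∉ outer G v))

lemma mem_recv {c v : V} :
    v ∈ recv G c ↔ (N2 G v).card ≤ 2 ∧ (G.Adj c v ∨ (c ∈ N2 G v ∧ c ∉ outer G v)) := by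
  simp [recv]

/-- The charge that `v` receives in the second step. -/
noncomputable def inc (G : SimpleGraph V) (d : ℕ) (v : V) : ℝ :=
  ∑ c, if v ∈ recv G c then max 0 (ch G d c - tau d) / (recv G c).card else 0

lemma discharge (h : ∀ v, tau d ≤ ch G d v ∨ tau d ≤ ch G d v + inc G d v) :
    tau d * Fintype.card V ≤ ∑ v : V, ((N2 G v).card : ℝ) := by
  have hinc : ∀ v, 0 ≤ inc G d v := by
    intro v; apply sum_nonneg; intro c _; split_ifs <;> positivity
  have h1 : ∑ v, ch G d v = ∑ v, ((N2 G v).card : ℝ) := by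
    simp only [ch, sum_sub_distrib, sum_add_distrib]
    rw [sum_comm]; ring
  have h2 : ∑ v, inc G d v ≤ ∑ v, max 0 (ch G d v - tau d) := by
    simp only [inc]
    rw [sum_comm]
    apply sum_le_sum
    intro c _
    rw [sum_ite_mem, univ_inter, sum_const, nsmul_eq_mul]
    by_cases h0 : ((recv G c).card : ℝ) = 0
    · rw [h0]; simp
    · rw [mul_div_cancel₀ _ h0]
  have h3 : ∀ v, tau d ≤ ch G d v - max 0 (ch G d v - tau d) + inc G d v := by
    intro v
    have := hinc v
    rcases le_total (ch G d v) (tau d) with hle | hle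
    · rw [max_eq_left (by linarith)]
      rcases h v with h' | h' <;> linarith
    · rw [max_eq_right (by linarith)]; linarith
  have h4 := sum_le_sum fun v (_ : v ∈ (univ : Finset V)) => h3 v
  rw [sum_add_distrib, sum_sub_distrib, h1, sum_const, nsmul_eq_mul, card_univ] at h4
  linarith

lemma le_inc {v : V} {A : Finset V} {e k : ℝ}
    (hA : ∀ c ∈ A, v ∈ recv G c ∧ e ≤ ch G d c - tau d ∧ ((recv G c).card : ℝ) ≤ k) :
    A.card * (e / k) ≤ inc G d v := by
  rw [← nsmul_eq_mul, ← sum_const]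
  refine le_trans ?_ (sum_le_univ_sum_of_nonneg (s := A) ?_)
  · apply sum_le_sum
    intro c hc
    obtain ⟨h1, h2, h3⟩ := hA c hc
    rw [if_pos h1]
    have : (0 : ℝ) < (recv G c).card := by exact_mod_cast card_pos.2 ⟨v, h1⟩
    exact div_le_div₀ (le_max_left _ _) (h2.trans (le_max_right _ _)) this h3
  · intro c; split_ifs <;> positivity

lemma alpha_nonneg (hd : 9 ≤ d) : 0 ≤ alpha d := by
  have : (9 : ℝ) ≤ d := by exact_mod_cast hd
  rw [alpha, sub_nonneg, div_le_one (by linarith)]; linarith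

lemma alpha_le_one (hd : 9 ≤ d) : alpha d ≤ 1 := by
  have : (9 : ℝ) ≤ d := by exact_mod_cast hd
  have : 0 ≤ 4 / ((d : ℝ) - 2) := div_nonneg (by norm_num) (by linarith)
  rw [alpha]; linarith

lemma alpha_le (hd : 9 ≤ d) : alpha d ≤ tau d - 1 := by
  have : (9 : ℝ) ≤ d := by exact_mod_cast hd
  have h1 : 20 / (d : ℝ) - 4 / ((d : ℝ) - 2) ≤ 2 := by
    rw [div_sub_div _ _ (by linarith) (by linarith), div_le_iff₀ (by nlinarith)]
    nlinarith
  rw [alpha, tau]; linarith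

lemma tau_le : tau d ≤ 4 := by
  rw [tau]; have : (0 : ℝ) ≤ 20 / d := by positivity
  linarith

/-- The loss `4 / (d - 2)` is small against `20 / d`. -/
lemma loss_le (hd : 9 ≤ d) : 4 / ((d : ℝ) - 2) ≤ 6 / d := by
  have : (9 : ℝ) ≤ d := by exact_mod_cast hd
  rw [div_le_div_iff₀ (by linarith) (by linarith)]; linarith

lemma gift_nonneg (hd : 9 ≤ d) (x u : V) : 0 ≤ gift G d x u := by
  have h1 := alpha_nonneg hd
  have h2 := alpha_le hd
  rw [gift]; split_ifs <;> first | positivity | linarith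

lemma alpha_div_le (hd : 9 ≤ d) {n : ℕ} : alpha d / n ≤ alpha d := by
  rcases Nat.eq_zero_or_pos n with rfl | hn
  · simpa using alpha_nonneg hd
  · exact div_le_self (alpha_nonneg hd) (by exact_mod_cast hn)

lemma gift_le (hd : 9 ≤ d) (x u : V) : gift G d x u ≤ tau d - 1 := by
  have h1 := alpha_nonneg hd
  have h2 := alpha_le hd
  have h3 := alpha_div_le hd (n := (donors G d u).card)
  rw [gift]; split_ifs <;> linarith

lemma gift_le_alpha (hd : 9 ≤ d) {x u : V}
    (h : x ∈ donors G d u → (N2 G u).card = 1 → (nb G x ∩ cl G u).card + 1 ≠ d) :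
    gift G d x u ≤ alpha d := by
  have h1 := alpha_nonneg hd
  have h3 := alpha_div_le hd (n := (donors G d u).card)
  rw [gift]; split_ifs with a b c <;> first | linarith | exact absurd c (h a b)

lemma gift_eq_zero {x u : V} (h : x ∈ donors G d u → ¬ (N2 G u).card ≤ 3) :
    gift G d x u = 0 := by
  rw [gift]
  split_ifs with a <;> first | rfl | exact absurd (by omega) (h a)

lemma N2_card_le_ch (hd : 9 ≤ d) {v : V} {out : ℝ} (h : ∑ u, gift G d v u ≤ out) :
    (N2 G v).card - out ≤ ch G d v := by
  have : 0 ≤ ∑ x, gift G d x v := sum_nonneg fun x _ => gift_nonneg hd x v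
  rw [ch]; linarith

/-- A set of `d + 2` vertices that is joined to the rest of the graph by a single edge `wq`. -/
structure BEnd (G : SimpleGraph V) (d : ℕ) (R : Finset V) (w q : V) : Prop where
  card : R.card = d + 2
  cut : Cut G R q
  mem : w ∈ R
  adj : G.Adj q w
  unique : ∀ y ∈ R, G.Adj q y → y = w

namespace BEnd
variable {R : Finset V} {w q : V}

lemma isTail (hB : BEnd G d R w q) (hreg : ∀ v, (nb G v).card = d) : IsTail G d (↑R) w := by
  apply isTail_of_closed hreg hB.card hB.mem
  · intro v hv hvw
    exact hB.cut.nb_sub hv fun h => hvw (hB.unique v hv h)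
  · rw [hB.cut.sdiff_eq hB.mem hB.adj, card_singleton]

lemma nonnb_end (hB : BEnd G d R w q) (hreg : ∀ v, (nb G v).card = d) :
    (nonnb G R w).card = 2 := by
  have := nonnb_card hreg hB.mem
  rw [hB.cut.sdiff_eq hB.mem hB.adj, card_singleton, hB.card] at this
  omega

lemma nonnb_of_ne (hB : BEnd G d R w q) (hreg : ∀ v, (nb G v).card = d) {y : V} (hy : y ∈ R)
    (hyw : y ≠ w) : (nonnb G R y).card = 1 := by
  have h1 := nonnb_card hreg hy
  have h2 := sdiff_empty_iff.2 (hB.cut.nb_sub hy fun h => hyw (hB.unique y hy h))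
  have := hB.card
  omega

lemma card_end (hB : BEnd G d R w q) (h : Ctx G d) : d + 1 ≤ (N2 G w).card := by
  have h1 : nonnb G R w ∪ nb G q \ R ⊆ N2 G w := by
    intro y hy
    rcases mem_union.1 hy with hy | hy
    · have hy' := mem_nonnb.1 hy
      refine common_nb hB.mem hy'.1 hy'.2.1.symm hy'.2.2 ?_
      rw [hB.nonnb_end h.reg, hB.nonnb_of_ne h.reg hy'.1 hy'.2.1, hB.card]
      have := h.deg
      omega
    · exact hB.cut.sdiff_sub_N2 hB.mem hB.adj hy
  have h2 := card_le_card h1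
  rw [card_union_of_disjoint, hB.nonnb_end h.reg] at h2
  · have h3 := nb_sdiff_card h.reg R q
    have h4 : nb G q ∩ R = {w} := by
      ext y
      simp only [mem_inter, mem_nb, mem_singleton]
      exact ⟨fun hy => hB.unique y hy.2 hy.1, by rintro rfl; exact ⟨hB.adj, hB.mem⟩⟩
    rw [h4, card_singleton] at h3
    omega
  · rw [disjoint_left]
    intro y hy hy'
    exact (mem_sdiff.1 hy').2 (mem_nonnb.1 hy).1

/-- As the end of the tail `R`, `w` pays only inside `R`, hence only its two non-neighbours there,
at most `tau d - 1` each. -/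
lemma ch_end (hB : BEnd G d R w q) (h : Ctx G d) : (d : ℝ) + 3 - 2 * tau d ≤ ch G d w := by
  have h1 : ∑ u, gift G d w u ≤ 2 * (tau d - 1) := by
    have h2 : ∑ u, gift G d w u = ∑ u ∈ nonnb G R w, gift G d w u := by
      symm
      apply sum_subset (subset_univ _)
      intro u _ hu
      apply gift_eq_zero
      intro hw
      exfalso
      obtain ⟨ho, hf, -⟩ := mem_donors.1 hw
      have huR : u ∈ R := by
        by_contra huR
        exact hf ⟨_, hB.isTail h.reg, huR⟩
      have := mem_N2.1 (outer_subset _ ho)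
      exact hu (mem_nonnb.2 ⟨huR, this.1.symm, fun e => this.2.1 e.symm⟩)
    rw [h2]
    refine (sum_le_sum fun u _ => gift_le h.deg w u).trans ?_
    rw [sum_const, hB.nonnb_end h.reg]; simp
  have h2 := N2_card_le_ch h.deg h1
  have h3 : ((d + 1 : ℕ) : ℝ) ≤ (N2 G w).card := by exact_mod_cast hB.card_end h
  push_cast at h3
  linarith

end BEnd

lemma Pend.exists_bEnd {l x : V} (hp : Pend G d l x) (hreg : ∀ v, (nb G v).card = d)
    (ha : (nb G x ∩ cl G l).card + 1 = d) : ∃ q, BEnd G d (insert x (cl G l)) x q := by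
  have h1 := nb_sdiff_card hreg (cl G l) x
  obtain ⟨q, hq⟩ := card_eq_one.1 (show (nb G x \ cl G l).card = 1 by omega)
  have hq' : ∀ y, (G.Adj x y ∧ y ∉ cl G l) ↔ y = q := by
    intro y; rw [← mem_nb, ← mem_sdiff, hq, mem_singleton]
  have hq0 := (hq' q).2 rfl
  have hqC : ∀ y ∈ cl G l, ¬ G.Adj q y := fun y hy => hp.cut.not_adj hq0.2 hq0.1.ne.symm hy
  refine ⟨q, ?_, ⟨?_, ?_⟩, mem_insert_self _ _, hq0.1.symm, ?_⟩
  · rw [card_insert_of_notMem hp.cut.notMem, cl_card hreg]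
  · rw [mem_insert, not_or]; exact ⟨hq0.1.ne.symm, hq0.2⟩
  · intro v hv y hy
    rcases mem_insert.1 hv with rfl | hv
    · by_cases hyC : y ∈ cl G l
      · exact Or.inl (mem_insert_of_mem hyC)
      · exact Or.inr ((hq' y).1 ⟨hy, hyC⟩)
    · rcases hp.cut.out v hv y hy with h2 | rfl
      · exact Or.inl (mem_insert_of_mem h2)
      · exact Or.inl (mem_insert_self _ _)
  · intro y hy hqy
    rcases mem_insert.1 hy with rfl | hy
    · rfl
    · exact absurd hqy (hqC y hy)

lemma Pend.eq_of_mem_outer {l x y : V} (hp : Pend G d l x) (hy : y ∈ RegularSquare.outer G l) :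
    y = x := by
  have := outer_subset _ hy
  rwa [hp.N2_eq, mem_singleton] at this

/-- If all `k` outer vertices ended tails, each would send one edge to the rest of the ball of
radius two. With `d` odd, `d(d + 4 - k) + k` is odd, against `even_boundary`. -/
lemma donors_nonempty (h : Ctx G d) {u : V} (hs : (N2 G u).card = 3) :
    (donors G d u).Nonempty := by
  by_cases hres : ∃ x ∈ outer G u, res G x
  · obtain ⟨x, hx, hr⟩ := hres
    exact (res_outer h hr hx hs.le).2
  by_contra hne
  have hf : ∀ x ∈ outer G u, forb G d x u := by
    intro x hx
    by_contra hf
    exact hne ⟨x, mem_donors.2 ⟨hx, hf, fun hr => hres ⟨x, hx, hr⟩⟩⟩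
  obtain ⟨x0, hx0⟩ := outer_nonempty h hs.le
  obtain ⟨T0, z0, hT0⟩ := (hf x0 hx0).tailAt h.reg (outer_subset _ hx0)
  have hodd := hT0.odd
  have hcN : Disjoint (cl G u) (N2 G u) := by
    rw [disjoint_left]; intro y hy hy'; rw [mem_cl] at hy; have := mem_N2.1 hy'; tauto
  have hev := even_boundary h.reg (W := cl G u ∪ N2 G u \ outer G u) (X := outer G u)
    (by
      rw [disjoint_union_left]
      exact ⟨hcN.mono_right (outer_subset _), sdiff_disjoint⟩)
    (by
      intro v hv y hy
      have : y ∈ cl G u ∨ y ∈ N2 G u := by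
        rcases mem_union.1 hv with hv | hv
        · exact mem_N2_of_adj hv hy
        · rw [mem_sdiff] at hv; exact mem_of_notMem_outer hv.1 hv.2 hy
      simp only [mem_union, mem_sdiff]
      tauto)
  have h1 : ∀ x ∈ outer G u, (nb G x ∩ (cl G u ∪ N2 G u \ outer G u)).card = 1 := by
    intro x hx
    obtain ⟨T, z, hT⟩ := (hf x hx).tailAt h.reg (outer_subset _ hx)
    rw [hT.inter_eq, card_singleton]
    · intro y hy
      rcases mem_union.1 hy with hy | hy
      · exact hT.cl_disj y hy
      · rw [mem_sdiff] at hy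
        exact hT.N2_disj y hy.1 (by rintro rfl; exact hy.2 hx)
    · simp [hT.adj']
  have h2 := card_le_card (outer_subset (G := G) u)
  rw [sum_congr rfl h1, sum_const, smul_eq_mul, mul_one,
    card_union_of_disjoint (hcN.mono_right sdiff_subset), cl_card h.reg,
    card_sdiff_of_subset (outer_subset _), hs] at hev
  have h3 : 0 < (outer G u).card := card_pos.2 ⟨x0, hx0⟩
  rw [hs] at h2
  rw [← Nat.not_even_iff_odd] at hodd
  interval_cases (outer G u).card <;>
    simp [Nat.even_add_one, Nat.even_mul, hodd] at hev

lemma ch_of_three_le (h : Ctx G d) {v : V} (hs : 3 ≤ (N2 G v).card)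
    (hout : ∀ u, v ∈ donors G d u → ¬ (N2 G u).card ≤ 3) : 3 + alpha d ≤ ch G d v := by
  have h0 : ∑ u, gift G d v u = 0 := sum_eq_zero fun u _ => gift_eq_zero (hout u)
  rcases hs.eq_or_lt with h3 | h4
  · have h1 : ∑ x, gift G d x v = alpha d := by
      have h2 : ∀ x, gift G d x v =
          if x ∈ donors G d v then alpha d / (donors G d v).card else 0 := by
        intro x; rw [gift, ← h3]; simp
      simp only [h2]
      rw [sum_ite_mem, univ_inter, sum_const, nsmul_eq_mul, mul_div_cancel₀]
      have := card_pos.2 (donors_nonempty h h3.symm)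
      positivity
    rw [ch, h0, h1, ← h3]; norm_num
  · have h1 := N2_card_le_ch h.deg h0.le
    have h2 : (4 : ℝ) ≤ (N2 G v).card := by exact_mod_cast h4
    have h3 := alpha_le_one h.deg
    linarith

lemma tau_le_three_add (hd : 9 ≤ d) : tau d ≤ 3 + alpha d := by
  have h1 := loss_le hd
  have : (0 : ℝ) ≤ 14 / d := by positivity
  have h2 : 20 / (d : ℝ) = 6 / d + 14 / d := by ring
  rw [tau, alpha]; linarith

/-- A vertex that pays no one has at least `3 + alpha d`. The larger gift `tau d - 1` is paid only
by ends of B regions, where `3 * tau d ≤ 12 ≤ d + 3`. Any other payer loses at most `alpha d` per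
second neighbour, and `(d - 2)(1 - alpha d) = 4`. -/
lemma tau_le_ch (h : Ctx G d) {v : V} (hs : 3 ≤ (N2 G v).card) : tau d ≤ ch G d v := by
  have hd : (9 : ℝ) ≤ d := by exact_mod_cast h.deg
  by_cases h0 : ∀ u, v ∈ donors G d u → ¬ (N2 G u).card ≤ 3
  · exact (tau_le_three_add h.deg).trans (ch_of_three_le h hs h0)
  push Not at h0
  obtain ⟨u, hu, hu3⟩ := h0
  by_cases h1 : ∃ u, v ∈ donors G d u ∧ (N2 G u).card = 1 ∧ (nb G v ∩ cl G u).card + 1 = d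
  · obtain ⟨u, hv, hu1, ha⟩ := h1
    obtain ⟨x, hp⟩ := exists_pend h hu1
    have hvx := hp.eq_of_mem_outer (mem_donors.1 hv).1
    subst hvx
    obtain ⟨q, hB⟩ := hp.exists_bEnd h.reg ha
    have h2 := hB.ch_end h
    have h3 := tau_le (d := d)
    linarith
  · have h2 := outer_card h hu3 (mem_donors.1 hu).1
    have h3 : ∑ u, gift G d v u ≤ (N2 G v).card * alpha d := by
      rw [← nsmul_eq_mul, ← sum_const]
      have h4 : ∑ u, gift G d v u = ∑ u ∈ N2 G v, gift G d v u := by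
        symm
        apply sum_subset (subset_univ _)
        intro u _ hu
        apply gift_eq_zero
        intro hv
        exact absurd (N2_comm.1 (outer_subset _ (mem_donors.1 hv).1)) hu
      rw [h4]
      exact sum_le_sum fun u _ => gift_le_alpha h.deg fun a b c => h1 ⟨u, a, b, c⟩
    have h4 := N2_card_le_ch h.deg h3
    have h5 : (d : ℝ) - 2 ≤ (N2 G v).card := by
      have : (d : ℝ) ≤ (N2 G v).card + 2 := by exact_mod_cast h2
      linarith
    have h6 : ((d : ℝ) - 2) * (1 - alpha d) = 4 := by
      rw [alpha]; field_simp [show (d : ℝ) - 2 ≠ 0 by linarith]; ring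
    have h7 : 0 ≤ 1 - alpha d := sub_nonneg.2 (alpha_le_one h.deg)
    have h8 := mul_le_mul_of_nonneg_right h5 h7
    have h9 := tau_le (d := d)
    linarith

end Charge

/-! ### One second neighbour, or two of which one is not outer. -/

section Small
open scoped Classical
open Finset
variable {V : Type*} [Fintype V] {G : SimpleGraph V} {d : ℕ}

lemma one_sub_le_alpha (hd : 9 ≤ d) : 1 - 6 / (d : ℝ) ≤ alpha d := by
  have := loss_le hd
  rw [alpha]; linarith

/-- A share `n * (e / k)` of size at least `b - 14 / d` lifts the charge `4 - b - 6 / d` to `tau d`. -/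
lemma tau_le_of_share (hd : 9 ≤ d) {b n e k : ℝ} (hk : 0 < k)
    (h : k * (b * d - 14) ≤ n * (e * d)) : tau d ≤ 4 - b - 6 / d + n * (e / k) := by
  have hd' : (0 : ℝ) < d := by have : (9 : ℝ) ≤ d := by exact_mod_cast hd
                               linarith
  have h1 : b - 14 / d ≤ n * (e / k) := by
    rw [← sub_nonneg] at h ⊢
    have : n * (e / k) - (b - 14 / d) = (n * (e * d) - k * (b * d - 14)) / (k * d) := by
      field_simp
    rw [this]; positivity
  have h2 : 20 / (d : ℝ) = 6 / d + 14 / d := by ring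
  rw [tau]; linarith

lemma tau_mul (hd : 9 ≤ d) : tau d * d = 4 * d - 20 := by
  have : (d : ℝ) ≠ 0 := by have : 0 < d := by omega
                           positivity
  rw [tau]; field_simp

lemma ch_small (h : Ctx G d) {v : V} (hs : (N2 G v).card ≤ 3) :
    ch G d v = (N2 G v).card + ∑ x ∈ donors G d v, gift G d x v := by
  have h0 : ∑ u, gift G d v u = 0 := sum_eq_zero fun u _ => gift_eq_zero fun hv hu => by
    have := outer_card h hu (mem_donors.1 hv).1
    have := h.deg
    omega
  rw [ch, h0, sub_zero]
  congr 1
  symm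
  apply sum_subset (subset_univ _)
  intro x _ hx
  exact gift_eq_zero fun hx' => absurd hx' hx

lemma le_ch_small (h : Ctx G d) {v x : V} (hs : (N2 G v).card ≤ 3) (hx : x ∈ donors G d v) :
    (N2 G v).card + gift G d x v ≤ ch G d v := by
  rw [ch_small h hs]
  have := single_le_sum (f := fun x => gift G d x v) (fun y _ => gift_nonneg h.deg y v) hx
  simpa using this

lemma not_res (h : Ctx G d) {v x : V} (hs : (N2 G v).card ≤ 2) (hx : x ∈ outer G v) :
    ¬ res G x := by
  intro hr
  have := (res_outer h hr hx (by omega)).1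
  omega

lemma seven_le (h : Ctx G d) {v x : V} (hs : (N2 G v).card ≤ 3) (hx : x ∈ outer G v) :
    7 ≤ (N2 G x).card := by
  have := outer_card h hs hx
  have := h.deg
  omega

/-- Unless `x` pays everything, the `a` neighbours of `x` in `cl G v` make up the deficit. They are
`res`, so their charge is intact, and they share it only with the `t + 1 = d + 1 - a` vertices of
`cl G v` not adjacent to `x`. -/
lemma tau_le_of_card_eq_one (h : Ctx G d) {v : V} (hs : (N2 G v).card = 1) :
    tau d ≤ ch G d v + inc G d v := by
  obtain ⟨x, hp⟩ := exists_pend h hs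
  have hd : (9 : ℝ) ≤ d := by exact_mod_cast h.deg
  have hxd : x ∈ donors G d v := by
    refine mem_donors.2 ⟨hp.outer, ?_, not_res h (by omega) hp.outer⟩
    intro hf
    obtain ⟨T, z, hT⟩ := hf.tailAt h.reg (outer_subset _ hp.outer)
    have := hp.two_le
    rw [hT.inter_eq hT.cl_disj (by simp [hT.adj']), card_singleton] at this
    omega
  have h1 := le_ch_small h (by omega) hxd
  have hinc : 0 ≤ inc G d v := by
    have := le_inc (G := G) (d := d) (v := v) (A := ∅) (e := 0) (k := 1) (by simp)
    simpa using this
  rw [gift, if_pos hxd, if_pos hs, hs] at h1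
  push_cast at h1
  split_ifs at h1 with ha
  · linarith
  set a := (nb G x ∩ cl G v).card with ha'
  have ha2 := hp.two_le
  have hlt := hp.lt
  rw [← ha'] at ha2 hlt
  obtain ⟨t, ht⟩ : ∃ t, d = a + t := ⟨d - a, by omega⟩
  have ht2 : 2 ≤ t := by omega
  have key : ∀ c ∈ nb G x ∩ cl G v, v ∈ recv G c ∧ (t + 1 ≤ (N2 G c).card) ∧
      (∀ u, c ∈ donors G d u → ¬ (N2 G u).card ≤ 3) ∧
      ((recv G c).card : ℝ) ≤ (t : ℝ) + 1 := by
    intro c hc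
    simp only [mem_inter, mem_nb] at hc
    have hcv : c ≠ v := by rintro rfl; exact hp.not_adj_self hc.1
    have hvc : G.Adj v c := (mem_cl.1 hc.2).resolve_left hcv
    refine ⟨mem_recv.2 ⟨by omega, Or.inl hvc.symm⟩, ?_, ?_, ?_⟩
    · have := hp.big c hc.2 hc.1; omega
    · intro u hu _
      exact (mem_donors.1 hu).2.2 (hp.res_of_adj hc.2 hc.1)
    · have hsub : recv G c ⊆ cl G v \ nb G x := by
        intro y hy
        obtain ⟨hy1, hy2⟩ := mem_recv.1 hy
        have hyx : y ≠ x := by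
          rintro rfl
          have := seven_le h (by omega) hp.outer
          omega
        have hyC : y ∈ cl G v := by
          rcases hy2 with hy2 | ⟨hy2, hy3⟩
          · exact (hp.cut.out c hc.2 y hy2).resolve_right hyx
          · by_contra hyC
            have hxy := hp.cut.adj_of_N2 hc.2 (N2_comm.1 hy2) hyC hyx
            exact hy3 (hp.cut.mem_outer hyC hxy hc.2 hc.1 (by simp) hvc.symm hp.not_adj_self)
        refine mem_sdiff.2 ⟨hyC, fun hxy => ?_⟩
        have := hp.big y hyC (mem_nb.1 hxy)
        omega
      have h2 := card_le_card hsub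
      have h3 := card_sdiff_add_card_inter (cl G v) (nb G x)
      rw [inter_comm, cl_card h.reg] at h3
      have : (recv G c).card ≤ t + 1 := by omega
      exact_mod_cast this
  have hα := one_sub_le_alpha h.deg
  have hτ := tau_mul h.deg
  -- For `t = 2` counting second neighbours gives only `3`, which need not reach `tau d`. There
  -- `ch_of_three_le` supplies `3 + alpha d`, a surplus of `14/d = 20/d - 6/d`.
  rcases ht2.eq_or_lt with ht | ht3
  · have h2 := le_inc (G := G) (d := d) (v := v) (A := nb G x ∩ cl G v) (e := 14 / d)
      (k := 3) (fun c hc => ?_)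
    · have h3 := tau_le_of_share (d := d) h.deg (b := 2) (n := a) (e := 14 / d) (k := 3) (by norm_num) (by
        rw [div_mul_cancel₀ _ (by linarith)]
        have : (d : ℝ) = a + 2 := by exact_mod_cast (show d = a + 2 by omega)
        linarith)
      linarith
    · obtain ⟨k1, k2, k3, k4⟩ := key c hc
      refine ⟨k1, ?_, by rw [← ht] at k4; push_cast at k4; linarith⟩
      have := ch_of_three_le h (by omega) k3
      have h2 : 20 / (d : ℝ) = 6 / d + 14 / d := by ring
      rw [tau]; linarith
  · have h2 := le_inc (G := G) (d := d) (v := v) (A := nb G x ∩ cl G v) (e := t + 1 - tau d)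
      (k := t + 1) (fun c hc => ?_)
    · have h3 := tau_le_of_share (d := d) h.deg (b := 2) (n := a) (e := t + 1 - tau d) (k := t + 1)
        (by positivity) (by
          rw [sub_mul, hτ]
          -- Measured from the least values of `a` and `t`, the difference of the two sides becomes
          -- a polynomial with nonnegative coefficients.
          obtain ⟨i, hi⟩ := Nat.exists_eq_add_of_le ha2
          obtain ⟨j, hj⟩ := Nat.exists_eq_add_of_le (show 3 ≤ t from ht3)
          have e3 : (d : ℝ) = a + t := by exact_mod_cast ht
          rw [e3, hi, hj]
          push_cast
          rw [← sub_nonneg]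
          ring_nf
          positivity)
      linarith
    · obtain ⟨k1, k2, k3, k4⟩ := key c hc
      refine ⟨k1, ?_, k4⟩
      have h3 := N2_card_le_ch h.deg (v := c) (out := 0)
        (sum_eq_zero fun u _ => gift_eq_zero (k3 u)).le
      have h4 : (t : ℝ) + 1 ≤ (N2 G c).card := by exact_mod_cast k2
      linarith

lemma le_ch_two (h : Ctx G d) {v q : V} (hs : (N2 G v).card = 2) (hq : q ∈ outer G v)
    (hf : ¬ forb G d q v) : 3 - 6 / d ≤ ch G d v := by
  have hqd : q ∈ donors G d v := mem_donors.2 ⟨hq, hf, not_res h hs.le hq⟩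
  have h1 := le_ch_small h (by omega) hqd
  have h2 := one_sub_le_alpha h.deg
  rw [gift, if_pos hqd, hs] at h1
  norm_num at h1
  linarith

/-- The set `R = cl G v ∪ {p}` has `d + 2` vertices and is attached at `q` only. What `q` does not
pay comes from the `m` neighbours of `q` in `R`; fewer of them means that each sees more vertices
through `q`. -/
lemma tau_le_of_inner (h : Ctx G d) {v p q : V} (hN : N2 G v = {p, q}) (hpq : p ≠ q)
    (hp : p ∉ outer G v) (hq : q ∈ outer G v) : tau d ≤ ch G d v + inc G d v := by
  have hd : (9 : ℝ) ≤ d := by exact_mod_cast h.deg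
  have hd9 := h.deg
  have hτ := tau_mul h.deg
  have hτ4 := tau_le (d := d)
  have hs : (N2 G v).card = 2 := by rw [hN, card_pair hpq]
  have hpN : p ∈ N2 G v := by simp [hN]
  have hqN := outer_subset _ hq
  have hpN' := mem_N2.1 hpN
  have hqN' := mem_N2.1 hqN
  have hs7 := seven_le h (by omega) hq
  set R := insert p (cl G v) with hR
  have hpcl : p ∉ cl G v := by rw [mem_cl]; tauto
  have hRc : R.card = d + 2 := by rw [hR, card_insert_of_notMem hpcl, cl_card h.reg]
  have hvR : v ∈ R := by simp [hR]
  have hvq : ¬ G.Adj q v := fun e => hqN'.2.1 e.symm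
  have hcut : Cut G R q := by
    refine ⟨?_, ?_⟩
    · rw [hR, mem_insert, mem_cl]; have := hpq.symm; tauto
    · intro y hy z hyz
      have : z ∈ cl G v ∨ z ∈ N2 G v := by
        rcases mem_insert.1 hy with rfl | hy
        · exact mem_of_notMem_outer hpN hp hyz
        · exact mem_N2_of_adj hy hyz
      rw [hN, mem_insert, mem_singleton] at this
      rw [hR, mem_insert]; tauto
  have hev := even_boundary h.reg (W := R) (X := {q}) (by simpa using hcut.notMem)
    (by simpa using hcut.out)
  rw [sum_singleton, hRc] at hev
  have hsplit := nb_sdiff_card h.reg R q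
  obtain ⟨y0, hvy0, hy0q⟩ := hqN'.2.2
  have hy0R : y0 ∈ R := by simp [hR, hvy0]
  set m := (nb G q ∩ R).card with hm
  have hm1 : 1 ≤ m := card_pos.2 ⟨y0, by rw [mem_inter, mem_nb]; exact ⟨hy0q.symm, hy0R⟩⟩
  have hmd : m + 1 ≤ d := by
    obtain ⟨-, y, hy1, hy2, hy3⟩ := mem_outer.1 hq
    have : 0 < (nb G q \ R).card := by
      refine card_pos.2 ⟨y, ?_⟩
      rw [mem_sdiff, mem_nb, hR, mem_insert, not_or]
      exact ⟨hy1, by rintro rfl; exact hy3 hpN, hy2⟩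
    omega
  -- `d(d+2) + m` is even, so `m` and `d` have the same parity and `m = d - 1` is excluded.
  have hmd2 : m + 2 ≤ d := by
    by_contra hcon
    have e : d = m + 1 := by omega
    rw [e] at hev
    rcases Nat.even_or_odd m with h1 | h1
    · simp [Nat.even_add, Nat.even_mul, h1] at hev
    · rw [← Nat.not_even_iff_odd] at h1
      simp [Nat.even_add, h1] at hev
  have hbend : ∀ w, nb G q ∩ R = {w} → BEnd G d R w q := by
    intro w hw
    have hw' : ∀ y, (G.Adj q y ∧ y ∈ R) ↔ y = w := by
      intro y; rw [← mem_nb, ← mem_inter, hw, mem_singleton]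
    have := (hw' w).2 rfl
    exact ⟨hRc, hcut, this.2, this.1, fun y h1 h2 => (hw' y).1 ⟨h2, h1⟩⟩
  -- A tail ending at `q` would leave one edge between `q` and `R`, making `R` a B region and the
  -- graph a snake.
  have hnf : ¬ forb G d q v := by
    intro hf
    obtain ⟨T, z, hT⟩ := hf.tailAt h.reg hqN
    have hRT : ∀ y ∈ R, y ∉ T := by
      intro y hy
      rcases mem_insert.1 hy with rfl | hy
      · exact hT.N2_disj _ hpN hpq
      · exact hT.cl_disj y hy
    have hzR : z ∈ R := by simp [hR, hT.adj']
    have hB := hbend z (hT.inter_eq hRT hzR)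
    apply h.not_snake
    refine ⟨T, ↑R, q, z, hT.tail, hB.isTail h.reg, ?_, ?_, ?_⟩
    · rw [Set.disjoint_left]; intro y hy hy'; exact hRT y hy' hy
    · apply closed_univ h.conn ⟨v, Or.inr hvR⟩
      rintro a (ha | ha) y hy
      · by_cases haq : a = q
        · subst haq
          by_cases hyT : y ∈ T
          · exact Or.inl hyT
          · rw [hT.unique y hyT hy]; exact Or.inr hzR
        · exact Or.inl (hT.closed a ha haq y hy)
      · rcases hcut.out a ha y hy with h1 | rfl
        · exact Or.inr h1
        · exact Or.inl hT.mem
    · intro a ha y hy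
      constructor
      · intro hay
        have haq := (hcut.out y hy a hay.symm).resolve_left fun h' => hRT a h' ha
        subst haq
        exact ⟨rfl, hB.unique y hy hay⟩
      · rintro ⟨rfl, rfl⟩; exact hT.adj
  have hch := le_ch_two h hs hq hnf
  rcases hm1.eq_or_lt with hm1 | hm2
  · obtain ⟨w, hw⟩ := card_eq_one.1 hm1.symm
    have hB := hbend w hw
    have hwv : G.Adj w v := by rw [← hB.unique y0 hy0R hy0q.symm]; exact hvy0.symm
    have h2 := le_inc (G := G) (d := d) (v := v) (A := {w}) (e := d + 3 - 3 * tau d)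
      (k := d - 1) (fun c hc => ?_)
    · rw [card_singleton] at h2
      have h3 := tau_le_of_share (d := d) h.deg (b := 1) (n := (1 : ℕ)) (e := d + 3 - 3 * tau d)
        (k := d - 1) (by linarith) (by push_cast; nlinarith)
      linarith
    · rw [mem_singleton] at hc; subst hc
      refine ⟨mem_recv.2 ⟨hs.le, Or.inl hwv⟩, by have := hB.ch_end h; linarith, ?_⟩
      have hsub : recv G c ⊆ nb G c ∩ R := by
        intro y hy
        obtain ⟨hy1, hy2⟩ := mem_recv.1 hy
        have hyq : y ≠ q := by rintro rfl; omega
        rw [mem_inter, mem_nb]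
        rcases hy2 with hy2 | ⟨hy2, hy3⟩
        · exact ⟨hy2, (hcut.out c hB.mem y hy2).resolve_right hyq⟩
        · exfalso
          apply hy3
          have hcy := mem_N2.1 hy2
          by_cases hyR : y ∈ R
          · have hnq : ¬ G.Adj q y := fun e => hcy.1 (hB.unique y hyR e).symm
            refine mem_outer.2 ⟨hy2, q, hB.adj.symm, ?_, ?_⟩
            · rw [mem_cl, not_or]; exact ⟨hyq.symm, fun e => hnq e.symm⟩
            · intro hqy
              obtain ⟨-, -, b, h3, h4⟩ := mem_N2.1 hqy
              have := hB.unique b (hcut.nb_sub hyR hnq b h3) h4.symm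
              exact hcy.2.1 (this ▸ h3)
          · exact hcut.mem_outer hyR (hcut.adj_of_N2 hB.mem (N2_comm.1 hy2) hyR hyq) hB.mem hB.adj
              hvR hwv hvq
      have h2 := card_le_card hsub
      have h3 := nb_sdiff_card h.reg R c
      rw [hcut.sdiff_eq hB.mem hB.adj, card_singleton] at h3
      have : (recv G c).card + 1 ≤ d := by omega
      have : ((recv G c).card : ℝ) + 1 ≤ d := by exact_mod_cast this
      linarith
  · have hnn1 : ∀ c ∈ R, ¬ G.Adj q c → (nonnb G R c).card = 1 := by
      intro c hc hqc
      have h1 := nonnb_card h.reg hc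
      have h2 := sdiff_empty_iff.2 (hcut.nb_sub hc hqc)
      omega
    have hnn2 : ∀ c ∈ R, G.Adj q c → (nonnb G R c).card = 2 := by
      intro c hc hqc
      have h1 := nonnb_card h.reg hc
      rw [hcut.sdiff_eq hc hqc, card_singleton] at h1
      omega
    have hnnle : ∀ c ∈ R, (nonnb G R c).card ≤ 2 := by
      intro c hc
      by_cases hqc : G.Adj q c
      · exact (hnn2 c hc hqc).le
      · rw [hnn1 c hc hqc]; norm_num
    have hdense : ∀ c ∈ R, ∀ y ∈ R, y ∈ cl G c ∨ y ∈ N2 G c := by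
      intro c hc y hy
      by_cases hy' : y ∈ cl G c
      · exact Or.inl hy'
      · rw [mem_cl, not_or] at hy'
        refine Or.inr (common_nb hc hy (Ne.symm hy'.1) hy'.2 ?_)
        have := hnnle c hc; have := hnnle y hy
        omega
    have hbig : ∀ c ∈ R, G.Adj q c → d + 2 ≤ (N2 G c).card + m := by
      intro c hc hqc
      have h1 : nonnb G R c ∪ nb G q \ R ⊆ N2 G c := by
        intro y hy
        rcases mem_union.1 hy with hy | hy
        · have hy' := mem_nonnb.1 hy
          exact (hdense c hc y hy'.1).resolve_left (by rw [mem_cl, not_or]; exact hy'.2)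
        · exact hcut.sdiff_sub_N2 hc hqc hy
      have h2 := card_le_card h1
      rw [card_union_of_disjoint, hnn2 c hc hqc] at h2
      · omega
      · rw [disjoint_left]
        intro y hy hy'
        exact (mem_sdiff.1 hy').2 (mem_nonnb.1 hy).1
    have hRq : (R \ nb G q).card + m = d + 2 := by
      have := card_sdiff_add_card_inter R (nb G q)
      rw [inter_comm] at this
      omega
    have hfar : ∀ c ∈ R, G.Adj q c → ∃ c' ∈ R, G.Adj c c' ∧ ¬ G.Adj q c' := by
      intro c hc hqc
      by_contra hcon
      push Not at hcon
      have : R \ nb G q ⊆ nonnb G R c := by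
        intro y hy
        rw [mem_sdiff, mem_nb] at hy
        refine mem_nonnb.2 ⟨hy.1, ?_, fun e => hy.2 (hcon y hy.1 e)⟩
        rintro rfl; exact hy.2 hqc
      have := card_le_card this
      have := hnnle c hc
      omega
    have hother : ∀ y ∈ R, ¬ G.Adj q y → ∀ c ∈ nonnb G R y, G.Adj q c →
        ∃ c' ∈ R, G.Adj q c' ∧ G.Adj y c' := by
      intro y hy hqy c hc hqc
      obtain ⟨c', hc', hne⟩ := exists_mem_ne hm2 c
      rw [mem_inter, mem_nb] at hc'
      refine ⟨c', hc'.2, hc'.1, ?_⟩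
      by_contra hyc
      have h1 : c' ∈ nonnb G R y := mem_nonnb.2 ⟨hc'.2, by rintro rfl; exact hqy hc'.1, hyc⟩
      exact hne (card_le_one.1 (hnn1 y hy hqy).le c' h1 c hc)
    -- A recipient `u` must lie beyond `q`, since `R` and `q` are too close to every vertex of `R`
    -- when `m ≥ 2`. Then `N2 G u` properly contains the `m` neighbours of `q` in `R`, which forces
    -- `m = 2`, and both of them are donors.
    have hdon : ∀ c ∈ R, G.Adj q c → ∀ u, c ∈ donors G d u → (N2 G u).card ≤ 3 →
        m = 2 ∧ u ∈ nb G q \ R ∧ (N2 G u).card = 3 ∧ nb G q ∩ R ⊆ donors G d u := by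
      intro c hc hqc u hu hu3
      obtain ⟨ho, -, -⟩ := mem_donors.1 hu
      obtain ⟨hcN, y, hcy, hy1, hy2⟩ := mem_outer.1 ho
      have hcN' := mem_N2.1 hcN
      have huR : u ∉ R := by
        intro huR
        rcases hcut.out c hc y hcy with hyR | rfl
        · exact (hdense u huR y hyR).elim hy1 hy2
        · have hnq : ¬ G.Adj y u := fun e => hy1 (by simp [e.symm])
          obtain ⟨c', -, h1, h2⟩ := hother u huR hnq c (mem_nonnb.2 ⟨hc, hcN'.1, hcN'.2.1⟩) hqc
          exact hy2 (mem_N2.2 ⟨fun e => hy1 (by simp [e]), fun e => hnq e.symm, c', h2, h1.symm⟩)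
      have huq : u ≠ q := by rintro rfl; exact hcN'.2.1 hqc
      have hqu := hcut.adj_of_N2 hc (N2_comm.1 hcN) huR huq
      have hsub := hcut.sub_N2 huR hqu
      have hle := card_le_card hsub
      have hnot := hcut.not_N2_subset h.reg huR hqu hc hqc
      have hne : m ≠ (N2 G u).card := fun e =>
        hnot (eq_of_subset_of_card_le hsub (by omega)).symm.subset
      have hm2' : m = 2 := by omega
      refine ⟨hm2', by rw [mem_sdiff, mem_nb]; exact ⟨hqu, huR⟩, by omega, ?_⟩
      intro c' hc'
      rw [mem_inter, mem_nb] at hc'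
      obtain ⟨c'', h1, h2, h3⟩ := hfar c' hc'.2 hc'.1
      have ho' := hcut.mem_outer huR hqu hc'.2 hc'.1 h1 h2 h3
      refine mem_donors.2 ⟨ho', ?_, ?_⟩
      · intro hf
        obtain ⟨T, z, hT⟩ := hf.tailAt h.reg (outer_subset _ ho')
        -- A tail needs `d` odd, whereas `m = 2` makes `d` even.
        have hodd := hT.odd
        rw [← Nat.not_even_iff_odd] at hodd
        rw [hm2'] at hev
        simp [Nat.even_add, Nat.even_mul, hodd] at hev
      · rintro ⟨l, hl, hl1⟩
        rcases hcut.out c' hc'.2 l hl with hlR | rfl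
        · by_cases hql : G.Adj q l
          · have := hbig l hlR hql; omega
          · obtain ⟨k, hk⟩ := card_eq_one.1 (hnn1 l hlR hql)
            have hk' := mem_nonnb.1 (show k ∈ nonnb G R l by simp [hk])
            have h4 : ({k, q} : Finset V) ⊆ N2 G l := by
              intro z hz
              rw [mem_insert, mem_singleton] at hz
              rcases hz with rfl | rfl
              · exact (hdense l hlR z hk'.1).resolve_left (by rw [mem_cl, not_or]; exact hk'.2)
              · exact mem_N2.2 ⟨fun e => hcut.notMem (e ▸ hlR), fun e => hql e.symm, c', hl.symm,
                  hc'.1.symm⟩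
            have := card_le_card h4
            rw [card_pair (by rintro rfl; exact hcut.notMem hk'.1)] at this
            omega
        · omega
    have hrecv : ∀ c ∈ nb G q ∩ R, v ∈ recv G c ∧ ((recv G c).card : ℝ) ≤ d + 2 - m := by
      intro c hc
      rw [mem_inter, mem_nb] at hc
      refine ⟨mem_recv.2 ⟨hs.le, ?_⟩, ?_⟩
      · rcases mem_insert.1 hc.2 with rfl | hc'
        · exact Or.inr ⟨hpN, hp⟩
        · refine Or.inl ((mem_cl.1 hc').resolve_left ?_).symm
          rintro rfl; exact hvq hc.1
      · have hsub : recv G c ⊆ R \ nb G q := by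
          intro y hy
          obtain ⟨hy1, hy2⟩ := mem_recv.1 hy
          have hyq : y ≠ q := by rintro rfl; omega
          have hyR : y ∈ R := by
            rcases hy2 with hy2 | ⟨hy2, hy3⟩
            · exact (hcut.out c hc.2 y hy2).resolve_right hyq
            · by_contra hyR
              obtain ⟨c', h1, h2, h3⟩ := hfar c hc.2 hc.1
              exact hy3 (hcut.mem_outer hyR (hcut.adj_of_N2 hc.2 (N2_comm.1 hy2) hyR hyq) hc.2 hc.1
                h1 h2 h3)
          refine mem_sdiff.2 ⟨hyR, fun hqy => ?_⟩
          have := hbig y hyR (mem_nb.1 hqy)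
          omega
        have h2 := card_le_card hsub
        have h3 : (recv G c).card + m ≤ d + 2 := by omega
        have h4 : ((recv G c).card : ℝ) + m ≤ d + 2 := by exact_mod_cast h3
        linarith
    rcases (show 2 ≤ m from hm2).eq_or_lt with hm2' | hm3
    · have h2 := le_inc (G := G) (d := d) (v := v) (A := nb G q ∩ R) (e := (d + 6) / 2 - tau d)
        (k := d) (fun c hc => ?_)
      · rw [← hm, ← hm2'] at h2
        have h3 := tau_le_of_share (d := d) h.deg (b := 1) (n := (2 : ℕ))
          (e := (d + 6) / 2 - tau d) (k := d) (by linarith) (by push_cast; nlinarith)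
        linarith
      · obtain ⟨h3, h4⟩ := hrecv c hc
        rw [mem_inter, mem_nb] at hc
        rw [← hm2'] at h4
        push_cast at h4
        refine ⟨h3, ?_, by linarith⟩
        -- The recipients are among the `d - 2` neighbours of `q` outside `R`, and each splits its
        -- `alpha d` between at least two donors. Thus `c` keeps at least `d - (d - 6)/2 = (d +
        -- 6)/2`.
        have h5 : ∑ u, gift G d c u ≤ (d - 2) * (alpha d / 2) := by
          have h6 : ∑ u, gift G d c u = ∑ u ∈ nb G q \ R, gift G d c u := by
            symm
            apply sum_subset (subset_univ _)
            intro u _ hu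
            exact gift_eq_zero fun hcu hu3 => hu (hdon c hc.2 hc.1 u hcu hu3).2.1
          have h7 : (((nb G q \ R).card : ℕ) : ℝ) = d - 2 := by
            have : (nb G q \ R).card + 2 = d := by omega
            rw [← this]; push_cast; ring
          rw [h6, ← h7, ← nsmul_eq_mul, ← sum_const]
          apply sum_le_sum
          intro u _
          have hα := alpha_nonneg h.deg
          by_cases hcu : c ∈ donors G d u ∧ (N2 G u).card ≤ 3
          · obtain ⟨-, -, h8, h9⟩ := hdon c hc.2 hc.1 u hcu.1 hcu.2
            rw [gift, if_pos hcu.1, h8]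
            norm_num
            have h10 := card_le_card h9
            have h11 : (2 : ℝ) ≤ (donors G d u).card := by
              exact_mod_cast (show 2 ≤ (donors G d u).card by omega)
            exact div_le_div_of_nonneg_left hα (by norm_num) h11
          · rw [gift_eq_zero fun h8 h9 => hcu ⟨h8, h9⟩]
            positivity
        have h6 := N2_card_le_ch h.deg h5
        have h7 : (d : ℝ) ≤ (N2 G c).card := by
          have := hbig c hc.2 hc.1
          exact_mod_cast (show d ≤ (N2 G c).card by omega)
        have h8 : ((d : ℝ) - 2) * (alpha d / 2) = (d - 6) / 2 := by
          rw [alpha]; field_simp [show (d : ℝ) - 2 ≠ 0 by linarith]; ring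
        linarith
    · have hm3' : (3 : ℝ) ≤ m := by exact_mod_cast hm3
      have hmd' : (m : ℝ) + 2 ≤ d := by exact_mod_cast hmd2
      have h2 := le_inc (G := G) (d := d) (v := v) (A := nb G q ∩ R) (e := d + 2 - m - tau d)
        (k := d + 2 - m) (fun c hc => ?_)
      · rw [← hm] at h2
        have h3 := tau_le_of_share (d := d) h.deg (b := 1) (n := m) (e := d + 2 - m - tau d)
          (k := d + 2 - m) (by linarith) (by
            have e3 : ((d : ℝ) + 2 - m - tau d) * d = (d + 2 - m) * d - (4 * d - 20) := by
              rw [← hτ]; ring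
            rw [e3]
            obtain ⟨i, hi⟩ := Nat.exists_eq_add_of_le (show 3 ≤ m from hm3)
            obtain ⟨j, hj⟩ := Nat.exists_eq_add_of_le hmd2
            rw [hj, hi]
            push_cast
            rw [← sub_nonneg]
            ring_nf
            positivity)
        linarith
      · obtain ⟨h3, h4⟩ := hrecv c hc
        rw [mem_inter, mem_nb] at hc
        refine ⟨h3, ?_, h4⟩
        have h5 := N2_card_le_ch h.deg (v := c) (out := 0)
          (sum_eq_zero fun u _ => gift_eq_zero fun h6 h7 => by
            have := (hdon c hc.2 hc.1 u h6 h7).1; omega).le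
        have h6 : (d : ℝ) + 2 ≤ (N2 G c).card + m := by exact_mod_cast hbig c hc.2 hc.1
        linarith

end Small

/-! ### Two outer second neighbours, and the final count. -/

section Final
open scoped Classical
open Finset
variable {V : Type*} [Fintype V] {G : SimpleGraph V} {d : ℕ}

/-- Since `w` abstains, `cl G v` together with the tail behind `w` plays the role of the dense set,
with cut vertex `q`. The payers are the neighbours of `q` in `cl G v` other than `z`, the vertex
that carries the edge to the tail. -/
lemma tau_le_of_forb (h : Ctx G d) {v w q : V} (hN : N2 G v = {w, q}) (hwq : w ≠ q)
    (hw : w ∈ outer G v) (hq : q ∈ outer G v) (hf : forb G d w v) :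
    tau d ≤ ch G d v + inc G d v := by
  have hd : (9 : ℝ) ≤ d := by exact_mod_cast h.deg
  have hd9 := h.deg
  have hτ := tau_mul h.deg
  have hτ4 := tau_le (d := d)
  have hα := one_sub_le_alpha h.deg
  have hs : (N2 G v).card = 2 := by rw [hN, card_pair hwq]
  have hwN := outer_subset _ hw
  have hqN := outer_subset _ hq
  have hwN' := mem_N2.1 hwN
  have hqN' := mem_N2.1 hqN
  have hq7 := seven_le h (by omega) hq
  have hvq : ¬ G.Adj q v := fun e => hqN'.2.1 e.symm
  obtain ⟨T, z, hT⟩ := hf.tailAt h.reg hwN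
  obtain ⟨hcw, hcz⟩ := hT.card_end h.reg
  have hqT : q ∉ T := hT.N2_disj q hqN hwq.symm
  have hCT := hT.cl_disj
  have hzC : z ∈ cl G v := by simp [hT.adj']
  have hzv : z ≠ v := by rintro rfl; exact hwN'.2.1 hT.adj.symm
  have hqC : q ∉ cl G v := by rw [mem_cl]; tauto
  have hwC : w ∉ cl G v := by rw [mem_cl]; tauto
  have hCc := cl_card h.reg v
  have hout : ∀ y ∈ cl G v, ∀ a, G.Adj y a → a ∈ cl G v ∨ a = w ∨ a = q := by
    intro y hy a hya
    have := mem_N2_of_adj hy hya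
    rwa [hN, mem_insert, mem_singleton] at this
  have hwadj : ∀ y ∈ cl G v, G.Adj y w → y = z := fun y hy hyw => hT.unique y (hCT y hy) hyw.symm
  have hcut : Cut G (cl G v ∪ T.toFinset) q := by
    refine ⟨by simp only [mem_union, Set.mem_toFinset]; tauto, ?_⟩
    intro y hy a hya
    simp only [mem_union, Set.mem_toFinset] at hy ⊢
    rcases hy with hy | hy
    · rcases hout y hy a hya with h1 | rfl | h1
      · exact Or.inl (Or.inl h1)
      · exact Or.inl (Or.inr hT.mem)
      · exact Or.inr h1
    · by_cases hyw : y = w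
      · subst hyw
        by_cases haT : a ∈ T
        · exact Or.inl (Or.inr haT)
        · rw [hT.unique a haT hya]; exact Or.inl (Or.inl hzC)
      · exact Or.inl (Or.inr (hT.closed y hy hyw a hya))
  have hqT' : ∀ y ∈ T, ¬ G.Adj q y := by
    intro y hy hqy
    by_cases hyw : y = w
    · subst hyw
      exact hqC (hT.unique q hqT hqy.symm ▸ hzC)
    · exact hqT (hT.closed y hy hyw q hqy.symm)
  have hPq : nb G q ∩ (cl G v ∪ T.toFinset) = nb G q ∩ cl G v := by
    ext y
    simp only [mem_inter, mem_nb, mem_union, Set.mem_toFinset]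
    have := hqT' y
    tauto
  have hev := even_boundary h.reg (W := cl G v) (X := {w, q})
    (by rw [disjoint_right]; simp only [mem_insert, mem_singleton]; rintro a (rfl | rfl) <;> assumption)
    (by simpa only [mem_insert, mem_singleton] using hout)
  rw [sum_pair hwq, hT.inter_eq hCT hzC, card_singleton, hCc] at hev
  have hsplit := nb_sdiff_card h.reg (cl G v) q
  obtain ⟨y0, hvy0, hy0q⟩ := hqN'.2.2
  have hy0C : y0 ∈ cl G v := by simp [hvy0]
  set m := (nb G q ∩ cl G v).card with hm
  have hm1 : 1 ≤ m := card_pos.2 ⟨y0, by rw [mem_inter, mem_nb]; exact ⟨hy0q.symm, hy0C⟩⟩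
  have hmd : m + 1 ≤ d := by
    obtain ⟨-, y, hy1, hy2, hy3⟩ := mem_outer.1 hq
    have : 0 < (nb G q \ cl G v).card := card_pos.2 ⟨y, by rw [mem_sdiff, mem_nb]; exact ⟨hy1, hy2⟩⟩
    omega
  have hmodd : Odd m := by
    rw [← Nat.not_even_iff_odd]
    intro hme
    have h1 := Nat.even_mul_succ_self d
    rw [Nat.even_add] at hev
    have h2 := hev.1 h1
    simp [Nat.even_add, hme] at h2
  have hmd2 : m + 2 ≤ d := by
    by_contra hcon
    have e : d = m + 1 := by omega
    have h1 := hT.odd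
    rw [e] at h1
    exact (Nat.not_odd_iff_even.2 (hmodd.add_odd odd_one)) h1
  have hnn0 : ∀ c ∈ cl G v, c ≠ z → ¬ G.Adj q c → nonnb G (cl G v) c = ∅ := by
    intro c hc hcz hqc
    have h1 := nonnb_card h.reg hc
    have h2 : (nb G c \ cl G v).card = 0 := by
      rw [sdiff_empty_iff]
      intro y hy
      rcases hout c hc y hy with h1 | rfl | rfl
      · exact h1
      · exact absurd (hwadj c hc hy) hcz
      · exact absurd hy.symm hqc
    rw [← card_eq_zero]; omega
  have hsd1 : ∀ c ∈ cl G v, c ≠ z → G.Adj q c → nb G c \ cl G v = {q} := by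
    intro c hc hcz hqc
    ext y
    simp only [mem_sdiff, mem_nb, mem_singleton]
    constructor
    · rintro ⟨h1, h2⟩
      rcases hout c hc y h1 with h3 | rfl | h3
      · exact absurd h3 h2
      · exact absurd (hwadj c hc h1) hcz
      · exact h3
    · rintro rfl; exact ⟨hqc.symm, hqC⟩
  -- With a single edge to `q`, the set `cl G v` is a clique minus an edge and prolongs the tail, so
  -- its vertex `b` abstains towards everything beyond `q`.
  have htail : ∀ b, nb G q ∩ cl G v = {b} →
      b ≠ z ∧ b ∈ cl G v ∧ G.Adj q b ∧ (∀ y ∈ cl G v, G.Adj q y → y = b) ∧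
        IsTail G d (T ∪ ↑(cl G v)) b := by
    intro b hb
    have hb' : ∀ y, (G.Adj q y ∧ y ∈ cl G v) ↔ y = b := by
      intro y; rw [← mem_nb, ← mem_inter, hb, mem_singleton]
    obtain ⟨hqb, hbC⟩ := (hb' b).2 rfl
    have hbz : b ≠ z := by
      rintro rfl
      have h1 := nonnb_card h.reg hbC
      have h2 : 0 < (nb G b \ cl G v).card :=
        card_pos.2 ⟨q, by rw [mem_sdiff, mem_nb]; exact ⟨hqb.symm, hqC⟩⟩
      obtain ⟨y, hy⟩ := card_pos.1 (show 0 < (nonnb G (cl G v) b).card by omega)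
      have hy' := mem_nonnb.1 hy
      have h3 := mem_nonnb_comm hbC hy
      rw [hnn0 y hy'.1 hy'.2.1 fun e => hy'.2.1 ((hb' y).1 ⟨e, hy'.1⟩)] at h3
      simp at h3
    have hqz : ¬ G.Adj q z := fun e => hbz ((hb' z).1 ⟨e, hzC⟩).symm
    refine ⟨hbz, hbC, hqb, fun y h1 h2 => (hb' y).1 ⟨h2, h1⟩, ?_⟩
    refine IsTail.step T w _ z b hT.tail ?_ ?_ ?_
    · rw [Set.disjoint_left]; intro y hy hy'; exact hCT y hy' hy
    · refine cliqueMinusEdge_mk h.reg hCc hzC hbC hbz.symm ?_ ?_ ?_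
      · rw [card_eq_one]
        refine ⟨w, ?_⟩
        ext y
        simp only [mem_sdiff, mem_nb, mem_singleton]
        constructor
        · rintro ⟨h1, h2⟩
          rcases hout z hzC y h1 with h3 | h3 | rfl
          · exact absurd h3 h2
          · exact h3
          · exact absurd h1.symm hqz
        · rintro rfl; exact ⟨hT.adj.symm, hwC⟩
      · rw [hsd1 b hbC hbz hqb, card_singleton]
      · intro c hc h1 h2
        rw [← sdiff_empty_iff]
        have h3 := nonnb_card h.reg hc
        rw [hnn0 c hc h1 fun e => h2 ((hb' c).1 ⟨e, hc⟩), card_empty] at h3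
        omega
    · intro y hy a ha
      constructor
      · intro hya
        have hyw : y = w := by
          by_contra hyw
          exact hCT a ha (hT.closed y hy hyw a hya)
        subst hyw
        exact ⟨rfl, hwadj a ha hya.symm⟩
      · rintro ⟨rfl, rfl⟩; exact hT.adj
  have hnf : ¬ forb G d q v := by
    intro hf'
    obtain ⟨T', z', hT'⟩ := hf'.tailAt h.reg hqN
    have hz'C : z' ∈ cl G v := by simp [hT'.adj']
    obtain ⟨-, -, hqz', hun, htl⟩ := htail z' (hT'.inter_eq hT'.cl_disj hz'C)
    have hwT' : w ∉ T' := hT'.N2_disj w hwN hwq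
    -- Neither tail contains the end of the other, so their intersection has no exit. By
    -- connectivity it is empty or everything, and `q` is not in `T`.
    have hTT : Disjoint T T' := by
      rw [Set.disjoint_iff_inter_eq_empty]
      by_contra hne
      have : T ∩ T' = Set.univ := by
        apply closed_univ h.conn (Set.nonempty_iff_ne_empty.2 hne)
        rintro y ⟨h1, h2⟩ a hya
        exact ⟨hT.closed y h1 (by rintro rfl; exact hwT' h2) a hya,
          hT'.closed y h2 (by rintro rfl; exact hqT h1) a hya⟩
      have : q ∈ T ∩ T' := by rw [this]; trivial
      exact hqT this.1
    apply h.not_snake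
    refine ⟨_, T', z', q, htl, hT'.tail, ?_, ?_, ?_⟩
    · rw [Set.disjoint_union_left]
      refine ⟨hTT, ?_⟩
      rw [Set.disjoint_left]; intro y hy; exact hT'.cl_disj y hy
    · apply closed_univ h.conn ⟨w, Or.inl (Or.inl hT.mem)⟩
      rintro a ha y hy
      rcases ha with ha | ha
      · have ha' : a ∈ cl G v ∪ T.toFinset := by
          simp only [mem_union, Set.mem_toFinset]
          exact Or.symm ha
        rcases hcut.out a ha' y hy with h1 | rfl
        · simp only [mem_union, Set.mem_toFinset] at h1
          exact Or.inl (Or.symm h1)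
        · exact Or.inr hT'.mem
      · by_cases haq : a = q
        · subst haq
          by_cases hyT : y ∈ T'
          · exact Or.inr hyT
          · rw [hT'.unique y hyT hy]; exact Or.inl (Or.inr hz'C)
        · exact Or.inr (hT'.closed a ha haq y hy)
    · intro a ha y hy
      constructor
      · intro hay
        have ha' : a ∉ T' := by
          rcases ha with ha | ha
          · exact Set.disjoint_left.1 hTT ha
          · exact hT'.cl_disj a ha
        have hyq : y = q := by
          by_contra hyq
          exact ha' (hT'.closed y hy hyq a hay.symm)
        subst hyq
        exact ⟨hT'.unique a ha' hay.symm, rfl⟩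
      · rintro ⟨rfl, rfl⟩; exact hT'.adj.symm
  have hch := le_ch_two h hs hq hnf
  have hbig : ∀ c ∈ cl G v, c ≠ z → G.Adj q c → d + 1 ≤ (N2 G c).card + m := by
    intro c hc hcz hqc
    have h1 := nonnb_card h.reg hc
    rw [hsd1 c hc hcz hqc, card_singleton] at h1
    have h2 : nonnb G (cl G v) c ∪ nb G q \ (cl G v ∪ T.toFinset) ⊆ N2 G c := by
      intro y hy
      rcases mem_union.1 hy with hy | hy
      · have hy' := mem_nonnb.1 hy
        exact (cl_sub_ball hc hy'.1).resolve_left (by rw [mem_cl, not_or]; exact hy'.2)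
      · exact hcut.sdiff_sub_N2 (mem_union_left _ hc) hqc hy
    have h3 := card_le_card h2
    rw [card_union_of_disjoint] at h3
    · have h4 := nb_sdiff_card h.reg (cl G v ∪ T.toFinset) q
      rw [hPq, ← hm] at h4
      omega
    · rw [disjoint_left]
      intro y hy hy'
      exact (mem_sdiff.1 hy').2 (mem_union_left _ (mem_nonnb.1 hy).1)
  have hN2c : ∀ c ∈ cl G v, c ≠ z → G.Adj q c → ∀ u ∈ N2 G c, u ∈ cl G v ∨ u = w ∨
      (u ∉ cl G v ∪ T.toFinset ∧ G.Adj q u) := by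
    intro c hc hcz hqc u hu
    have hu' := mem_N2.1 hu
    by_cases huP : u ∈ cl G v ∪ T.toFinset
    · simp only [mem_union, Set.mem_toFinset] at huP
      rcases huP with h1 | h1
      · exact Or.inl h1
      · right; left
        by_contra huw
        obtain ⟨-, -, y, h2, h3⟩ := hu'
        have hyT := hT.closed u h1 huw y h3.symm
        rcases hout c hc y h2 with h4 | rfl | rfl
        · exact hCT y h4 hyT
        · exact hcz (hwadj c hc h2)
        · exact hqT hyT
    · refine Or.inr (Or.inr ⟨huP, hcut.adj_of_N2 (mem_union_left _ hc) hu huP ?_⟩)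
      rintro rfl; exact hu'.2.1 hqc.symm
  have key : ∀ c ∈ (nb G q ∩ cl G v).erase z, v ∈ recv G c ∧ d + 1 ≤ (N2 G c).card + m ∧
      (∀ u, c ∈ donors G d u → ¬ (N2 G u).card ≤ 3) ∧
      recv G c ⊆ (cl G v \ nb G q).erase z := by
    intro c hc
    simp only [mem_erase, mem_inter, mem_nb] at hc
    obtain ⟨hcz, hqc, hcC⟩ := hc
    have hcv : c ≠ v := by rintro rfl; exact hvq hqc
    have hvc : G.Adj c v := ((mem_cl.1 hcC).resolve_left hcv).symm
    have hcP : c ∈ cl G v ∪ T.toFinset := mem_union_left _ hcC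
    refine ⟨mem_recv.2 ⟨hs.le, Or.inl hvc⟩, hbig c hcC hcz hqc, ?_, ?_⟩
    · intro u hu hu3
      obtain ⟨ho, hnfu, -⟩ := mem_donors.1 hu
      obtain ⟨hcN, y, hcy, hy1, hy2⟩ := mem_outer.1 ho
      have hcN' := mem_N2.1 hcN
      have huz : u ≠ z := by rintro rfl; omega
      rcases hN2c c hcC hcz hqc u (N2_comm.1 hcN) with huC | rfl | ⟨huP, hqu⟩
      · have hyC : y ∉ cl G v := fun hyC => (cl_sub_ball huC hyC).elim hy1 hy2
        have hyq : y = q := by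
          rcases hout c hcC y hcy with h1 | rfl | h1
          · exact absurd h1 hyC
          · exact absurd (hwadj c hcC hcy) hcz
          · exact h1
        subst hyq
        have h1 := hnn0 u huC huz fun e => hy1 (by simp [e.symm])
        have h2 : c ∈ nonnb G (cl G v) u := mem_nonnb.2 ⟨hcC, hcN'.1, hcN'.2.1⟩
        rw [h1] at h2
        simp at h2
      · omega
      · have hsub := hcut.sub_N2 huP hqu
        have hnot := hcut.not_N2_subset h.reg huP hqu hcP hqc
        rw [hPq] at hsub hnot
        have hle := card_le_card hsub
        have hne : m ≠ (N2 G u).card := fun e =>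
          hnot (eq_of_subset_of_card_le hsub (by omega)).symm.subset
        -- `m` is odd and less than `|N2 u| ≤ 3`. Then `c` ends a tail that avoids `u`, and cannot
        -- be a donor of `u`.
        have hm1' : m = 1 := by
          obtain ⟨k, hk⟩ := hmodd
          omega
        obtain ⟨b, hb⟩ := card_eq_one.1 (hm ▸ hm1')
        obtain ⟨-, -, -, hun, htl⟩ := htail b hb
        rw [hun c hcC hqc] at hnfu
        refine hnfu ⟨_, htl, ?_⟩
        simp only [mem_union, Set.mem_toFinset, not_or] at huP
        rintro (h1 | h1)
        · exact huP.2 h1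
        · exact huP.1 h1
    · intro y hy
      obtain ⟨hy1, hy2⟩ := mem_recv.1 hy
      have hyq : y ≠ q := by rintro rfl; omega
      have hyz : y ≠ z := by rintro rfl; omega
      have hyw : y ≠ w := by rintro rfl; omega
      have hyC : y ∈ cl G v := by
        rcases hy2 with hy2 | ⟨hy2, hy3⟩
        · rcases hout c hcC y hy2 with h1 | h1 | h1
          · exact h1
          · exact absurd h1 hyw
          · exact absurd h1 hyq
        · rcases hN2c c hcC hcz hqc y (N2_comm.1 hy2) with h1 | h1 | ⟨h1, h2⟩
          · exact h1
          · exact absurd h1 hyw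
          · exact absurd (hcut.mem_outer h1 h2 hcP hqc (by simp) hvc hvq) hy3
      refine mem_erase.2 ⟨hyz, mem_sdiff.2 ⟨hyC, fun hqy => ?_⟩⟩
      have := hbig y hyC hyz (mem_nb.1 hqy)
      omega
  have hCq : (cl G v \ nb G q).card + m = d + 1 := by
    have := card_sdiff_add_card_inter (cl G v) (nb G q)
    rw [inter_comm] at this
    omega
  have hout0 : ∀ c ∈ (nb G q ∩ cl G v).erase z, ((N2 G c).card : ℝ) ≤ ch G d c := by
    intro c hc
    have := N2_card_le_ch h.deg (v := c) (out := 0)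
      (sum_eq_zero fun u _ => gift_eq_zero ((key c hc).2.2.1 u)).le
    linarith
  rcases hm1.eq_or_lt with hm1 | hm2
  · obtain ⟨b, hb⟩ := card_eq_one.1 (hm ▸ hm1.symm)
    obtain ⟨hbz, hbC, hqb, hun, htl⟩ := htail b hb
    have h2 := le_inc (G := G) (d := d) (v := v) (A := {b}) (e := d - tau d)
      (k := d - 1) (fun c hc => ?_)
    · rw [card_singleton] at h2
      have h3 := tau_le_of_share (d := d) h.deg (b := 1) (n := (1 : ℕ)) (e := d - tau d)
        (k := d - 1) (by linarith) (by push_cast; nlinarith)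
      linarith
    · rw [mem_singleton] at hc; subst hc
      have hcA : c ∈ (nb G q ∩ cl G v).erase z := by simp [hb, hbz]
      obtain ⟨h3, h4, -, h5⟩ := key c hcA
      refine ⟨h3, ?_, ?_⟩
      · have h6 := hout0 c hcA
        have h7 : (d : ℝ) ≤ (N2 G c).card := by
          exact_mod_cast (show d ≤ (N2 G c).card by omega)
        linarith
      · have h6 := card_le_card h5
        rw [card_erase_of_mem] at h6
        · have : (recv G c).card + 1 ≤ d := by omega
          have : ((recv G c).card : ℝ) + 1 ≤ d := by exact_mod_cast this
          linarith
        · rw [mem_sdiff, mem_nb]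
          exact ⟨hzC, fun e => hbz (hun z hzC e).symm⟩
  · have hm3 : 3 ≤ m := by
      obtain ⟨k, hk⟩ := hmodd
      omega
    have hmd' : (m : ℝ) + 2 ≤ d := by exact_mod_cast hmd2
    have hm3' : (3 : ℝ) ≤ m := by exact_mod_cast hm3
    -- One payer may be lost, because `z` itself may be adjacent to `q`.
    have hA : ((m : ℝ) - 1) ≤ ((nb G q ∩ cl G v).erase z).card := by
      have : m ≤ ((nb G q ∩ cl G v).erase z).card + 1 := by
        have := pred_card_le_card_erase (s := nb G q ∩ cl G v) (a := z)
        omega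
      have : (m : ℝ) ≤ ((nb G q ∩ cl G v).erase z).card + 1 := by exact_mod_cast this
      linarith
    have hrec : ∀ c ∈ (nb G q ∩ cl G v).erase z, ((recv G c).card : ℝ) ≤ d + 1 - m := by
      intro c hc
      have h6 := card_le_card ((key c hc).2.2.2.trans (erase_subset _ _))
      have : (recv G c).card + m ≤ d + 1 := by omega
      have : ((recv G c).card : ℝ) + m ≤ d + 1 := by exact_mod_cast this
      linarith
    rcases hmd2.eq_or_lt with hmd3 | hmd3
    · have e1 : (m : ℝ) = d - 2 := by
        rw [← hmd3]; push_cast; ring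
      have h2 := le_inc (G := G) (d := d) (v := v) (A := (nb G q ∩ cl G v).erase z) (e := 14 / d)
        (k := 3) (fun c hc => ⟨(key c hc).1, ?_, by have := hrec c hc; linarith⟩)
      · have h3 := tau_le_of_share (d := d) h.deg (b := 1) (n := m - 1) (e := 14 / d)
          (k := 3) (by norm_num) (by
            rw [div_mul_cancel₀ _ (by linarith), e1]
            linarith)
        have h4 : ((m : ℝ) - 1) * (14 / d / 3) ≤
            ((nb G q ∩ cl G v).erase z).card * (14 / d / 3) :=
          mul_le_mul_of_nonneg_right hA (by positivity)
        linarith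
      · obtain ⟨-, h4, h5, -⟩ := key c hc
        have := ch_of_three_le h (by omega) h5
        have h2 : 20 / (d : ℝ) = 6 / d + 14 / d := by ring
        rw [tau]; linarith
    · have h2 := le_inc (G := G) (d := d) (v := v) (A := (nb G q ∩ cl G v).erase z)
        (e := d + 1 - m - tau d) (k := d + 1 - m)
        (fun c hc => ⟨(key c hc).1, ?_, hrec c hc⟩)
      · have hmd4 : (m : ℝ) + 3 ≤ d := by exact_mod_cast hmd3
        have h3 := tau_le_of_share (d := d) h.deg (b := 1) (n := m - 1) (e := d + 1 - m - tau d)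
          (k := d + 1 - m) (by linarith) (by
            have e3 : ((d : ℝ) + 1 - m - tau d) * d = (d + 1 - m) * d - (4 * d - 20) := by
              rw [← hτ]; ring
            rw [e3]
            obtain ⟨i, hi⟩ := Nat.exists_eq_add_of_le hm3
            obtain ⟨j, hj⟩ := Nat.exists_eq_add_of_le (show m + 3 ≤ d from hmd3)
            rw [hj, hi]
            push_cast
            rw [← sub_nonneg]
            ring_nf
            positivity)
        have h4 : ((m : ℝ) - 1) * ((d + 1 - m - tau d) / (d + 1 - m)) ≤
            ((nb G q ∩ cl G v).erase z).card * ((d + 1 - m - tau d) / (d + 1 - m)) :=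
          mul_le_mul_of_nonneg_right hA (div_nonneg (by linarith) (by linarith))
        linarith
      · have h6 := hout0 c hc
        have h7 : (d : ℝ) + 1 ≤ (N2 G c).card + m := by exact_mod_cast (key c hc).2.1
        linarith

lemma tau_le_of_card_eq_two (h : Ctx G d) {v : V} (hs : (N2 G v).card = 2) :
    tau d ≤ ch G d v + inc G d v := by
  obtain ⟨p, q, hpq, hN⟩ := card_eq_two.1 hs
  have hN' : N2 G v = {q, p} := by rw [hN, pair_comm]
  have hmem : ∀ x ∈ outer G v, x = p ∨ x = q := by
    intro x hx
    have := outer_subset _ hx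
    rwa [hN, mem_insert, mem_singleton] at this
  obtain ⟨x, hx⟩ := outer_nonempty h (v := v) (by omega)
  by_cases hp : p ∈ outer G v
  · by_cases hq : q ∈ outer G v
    · by_cases hfp : forb G d p v
      · exact tau_le_of_forb h hN hpq hp hq hfp
      by_cases hfq : forb G d q v
      · exact tau_le_of_forb h hN' hpq.symm hq hp hfq
      have hpd : p ∈ donors G d v := mem_donors.2 ⟨hp, hfp, not_res h hs.le hp⟩
      have hqd : q ∈ donors G d v := mem_donors.2 ⟨hq, hfq, not_res h hs.le hq⟩
      have h1 := ch_small h (v := v) (by omega)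
      have h2 : ∑ x ∈ ({p, q} : Finset V), gift G d x v ≤ ∑ x ∈ donors G d v, gift G d x v := by
        apply sum_le_sum_of_subset_of_nonneg
        · intro y hy
          rw [mem_insert, mem_singleton] at hy
          rcases hy with rfl | rfl <;> assumption
        · intro y _ _; exact gift_nonneg h.deg y v
      rw [sum_pair hpq, gift, gift, if_pos hpd, if_pos hqd, hs] at h2
      norm_num at h2
      rw [hs] at h1
      push_cast at h1
      have hinc : 0 ≤ inc G d v := by
        have := le_inc (G := G) (d := d) (v := v) (A := ∅) (e := 0) (k := 1) (by simp)
        simpa using this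
      have h3 := one_sub_le_alpha h.deg
      have h4 : 20 / (d : ℝ) = 6 / d + 6 / d + 8 / d := by ring
      have h5 : (0 : ℝ) ≤ 8 / d := by positivity
      have h6 : tau d ≤ 4 - 20 / d := le_rfl
      linarith
    · exact tau_le_of_inner h hN' hpq.symm hq hp
  · have : x = q := (hmem x hx).resolve_left (by rintro rfl; exact hp hx)
    exact tau_le_of_inner h hN hpq hp (this ▸ hx)

lemma tau_mul_card_le (h : Ctx G d) :
    tau d * Fintype.card V ≤ ∑ v : V, ((N2 G v).card : ℝ) := by
  apply discharge
  intro v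
  by_cases hs : 3 ≤ (N2 G v).card
  · exact Or.inl (tau_le_ch h hs)
  · have h1 := card_pos.2 ((outer_nonempty h (v := v) (by omega)).mono (outer_subset v))
    right
    rcases (show (N2 G v).card = 1 ∨ (N2 G v).card = 2 by omega) with h2 | h2
    · exact tau_le_of_card_eq_one h h2
    · exact tau_le_of_card_eq_two h h2

lemma graphPower_two_adj {u v : V} :
    (graphPower G 2).Adj u v ↔ v ∈ nb G u ∪ N2 G u := by
  change u ≠ v ∧ G.edist u v ≤ ((2 : ℕ) : ℕ∞) ↔ _
  rw [mem_union, mem_nb, mem_N2]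
  constructor
  · rintro ⟨hne, hle⟩
    obtain ⟨p, hp⟩ := SimpleGraph.exists_walk_of_edist_ne_top
      (ne_top_of_le_ne_top (ENat.natCast_ne_top 2) hle)
    rw [← hp] at hle
    have hl : p.length ≤ 2 := by exact_mod_cast hle
    by_cases ha : G.Adj u v
    · exact Or.inl ha
    refine Or.inr ⟨hne.symm, ha, ?_⟩
    cases p with
    | nil => exact absurd rfl hne
    | cons h1 p =>
      cases p with
      | nil => exact absurd h1 ha
      | cons h2 p =>
        cases p with
        | nil => exact ⟨_, h1, h2⟩
        | cons h3 p => simp at hl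
  · rintro (ha | ⟨hne, -, y, h1, h2⟩)
    · refine ⟨ha.ne, ?_⟩
      rw [SimpleGraph.edist_eq_one_iff_adj.2 ha]; norm_num
    · refine ⟨hne.symm, ?_⟩
      have := (SimpleGraph.Walk.cons h1 (SimpleGraph.Walk.cons h2 SimpleGraph.Walk.nil)).edist_le
      simpa using this

lemma two_mul_ncard_edgeSet (H : SimpleGraph V) :
    2 * (H.edgeSet.ncard : ℝ) = ∑ v, ((nb H v).card : ℝ) := by
  have h1 := H.sum_degrees_eq_twice_card_edges
  have h2 : H.edgeSet.ncard = H.edgeFinset.card := by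
    rw [← SimpleGraph.coe_edgeFinset, Set.ncard_coe_finset]
  have h3 : ∀ v, H.degree v = (nb H v).card := by
    intro v
    rw [← SimpleGraph.card_neighborFinset_eq_degree]
    congr 1; ext y; simp
  simp only [h3] at h1
  rw [h2]
  exact_mod_cast h1.symm

lemma two_mul_edges_diff (G : SimpleGraph V) :
    2 * (((graphPower G 2).edgeSet.ncard : ℝ) - (G.edgeSet.ncard : ℝ)) =
      ∑ v, ((N2 G v).card : ℝ) := by
  rw [mul_sub, two_mul_ncard_edgeSet, two_mul_ncard_edgeSet, ← sum_sub_distrib]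
  refine sum_congr rfl fun v _ => ?_
  have : nb (graphPower G 2) v = nb G v ∪ N2 G v := by
    ext y; rw [mem_nb, graphPower_two_adj]
  rw [this, card_union_of_disjoint]
  · push_cast; ring
  · rw [disjoint_left]; intro y hy hy'
    exact (mem_N2.1 hy').2.1 (mem_nb.1 hy)

lemma one_le_N2_card (hconn : G.Connected) (hsq : graphPower G 2 ≠ ⊤) (v : V) :
    1 ≤ (N2 G v).card := by
  by_contra hc
  have h0 : N2 G v = ∅ := by rw [← card_eq_zero]; omega
  apply hsq
  have huniv : (↑(cl G v) : Set V) = Set.univ := by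
    apply closed_univ hconn ⟨v, by simp⟩
    intro y hy z hyz
    have := mem_N2_of_adj (mem_coe.1 hy) hyz
    simpa [h0] using this
  have hall : ∀ x, x ∈ cl G v := by
    intro x; rw [← mem_coe, huniv]; trivial
  ext x y
  rw [graphPower_two_adj, SimpleGraph.top_adj, mem_union]
  constructor
  · rintro (h1 | h1)
    · exact (mem_nb.1 h1).ne
    · exact (mem_N2.1 h1).1.symm
  · intro hxy
    rcases cl_sub_ball (hall x) (hall y) with h1 | h1
    · exact Or.inl (mem_nb.2 ((mem_cl.1 h1).resolve_left hxy.symm))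
    · exact Or.inr h1

lemma sum_N2_card_gt (hd : 6 < d) (hconn : G.Connected) (hreg : ∀ v, (nb G v).card = d)
    (hsq : graphPower G 2 ≠ ⊤) (hsnake : ¬ IsSnakeGraph G d) (hpeanut : ¬ IsPeanutGraph G d) :
    4 * (Fintype.card V : ℝ) * (1 - 2 / ((d : ℝ) + 1) - 3 / ((d : ℝ) - 3)) <
      ∑ v : V, ((N2 G v).card : ℝ) := by
  have hne := hconn.nonempty
  have hn : (0 : ℝ) < Fintype.card V := by exact_mod_cast Fintype.card_pos
  by_cases hd9 : 9 ≤ d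
  · have hd' : (9 : ℝ) ≤ d := by exact_mod_cast hd9
    have hctx : Ctx G d := by
      refine ⟨hd9, hreg, hconn, ?_, hsnake, hpeanut⟩
      by_contra hcon
      push Not at hcon
      apply hsq
      ext x y
      rw [graphPower_two_adj, SimpleGraph.top_adj, mem_union, mem_nb]
      constructor
      · rintro (h1 | h1)
        · exact h1.ne
        · exact (mem_N2.1 h1).1.symm
      · intro hxy
        by_cases ha : G.Adj x y
        · exact Or.inl ha
        · exact Or.inr (hcon x y hxy ha)
    refine lt_of_lt_of_le ?_ (tau_mul_card_le hctx)
    -- Convexity of the reciprocal: the mean of `d + 1` and `d - 3` with weights `2` and `3` is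
    -- below `d`.
    have h1 : 5 / (d : ℝ) < 2 / ((d : ℝ) + 1) + 3 / ((d : ℝ) - 3) := by
      rw [div_add_div _ _ (by linarith) (by linarith), div_lt_div_iff₀ (by linarith) (by nlinarith)]
      nlinarith
    have h2 : 4 * (1 - 2 / ((d : ℝ) + 1) - 3 / ((d : ℝ) - 3)) < tau d := by
      have : 20 / (d : ℝ) = 4 * (5 / d) := by ring
      rw [tau]; linarith
    nlinarith
  · have h1 : (Fintype.card V : ℝ) ≤ ∑ v : V, ((N2 G v).card : ℝ) := by
      rw [← card_univ, card_eq_sum_ones]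
      push_cast
      exact sum_le_sum fun v _ => by exact_mod_cast one_le_N2_card hconn hsq v
    refine lt_of_lt_of_le ?_ h1
    -- Here the required average is `0` or `32/45`, below the trivial value `1`.
    have : d = 7 ∨ d = 8 := by omega
    rcases this with rfl | rfl
    · norm_num; exact Fintype.card_pos
    · norm_num; linarith

end Final
end RegularSquare

theorem theorem1 {V : Type*} [Fintype V] (G : SimpleGraph V) [DecidableRel G.Adj] (d : ℕ)
    (hd : 6 < d) (hconn : G.Connected) (hreg : G.IsRegularOfDegree d)
    (hsq : graphPower G 2 ≠ ⊤) (hsnake : ¬ IsSnakeGraph G d) (hpeanut : ¬ IsPeanutGraph G d) :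
    2 * (Fintype.card V : ℝ) * (1 - 2 / ((d : ℝ) + 1) - 3 / ((d : ℝ) - 3)) <
      ((graphPower G 2).edgeSet.ncard : ℝ) - (G.edgeSet.ncard : ℝ) := by
  have hreg' : ∀ v, (RegularSquare.nb G v).card = d := by
    intro v
    rw [← hreg v, ← SimpleGraph.card_neighborFinset_eq_degree]
    congr 1
    ext y
    simp
  have h1 := RegularSquare.sum_N2_card_gt hd hconn hreg' hsq hsnake hpeanut
  have h2 := RegularSquare.two_mul_edges_diff G
  linarith
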